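/- Let $\mathcal E=\mathrm{Sh}(C,J)$ be the topos of sheaves on a small site. A "set" or "discrete space" is an object of $\mathcal E$; frames, Boolean algebras, ideals and locales are taken internally in $\mathcal E$, and statements about elements are interpreted in the internal logic of $\mathcal E$. The discrete space on a set $X$ is the locale whose frame of opens is the power object $\mathcal P X$; a locale is Stone if, for some Boolean algebra $A$, its frame of opens is isomorphic to the frame $\mathrm{Idl}(A)$ of ideals of $A$ (so that it is $\mathrm{Spec}\,A$). Let $X$ and $Y$ be sets, and suppose that the discrete space $Y$ is Stone. Then all products $Z\times X$ with a locale $Z$ and the exponential $Y^X$ exist in the category of locales of $\mathcal E$, and $Y^X$ is Stone. For $x\in X$ and $y\in Y$ the open $(x,y)=\{\theta\mid\theta(x)=y\}$ of $Y^X$ is clopen, and the Boolean algebra of clopens (complemented opens) of $Y^X$ is generated by these elements, indexed by $X\times Y$, subject to the following relations for each $x\in X$: $$1\le\bigvee_{y\in Y}(x,y),\qquad (x,y)\wedge(x,y')\le 0\quad\text{for all } y,y'\in Y \text{ with } y\ne y'.$$ That is, the clopens $(x,y)$ satisfy these relations, the first one meaning that $1$ is below every upper bound of the elements $(x,y)$,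 $y\in Y$; and for every Boolean algebra $A$ in $\mathcal E$ and every map $\delta\colon X\times Y\to A$ satisfying the same relations there is a unique homomorphism of Boolean algebras from the clopens of $Y^X$ to $A$ that sends $(x,y)$ to $\delta(x,y)$. -/

import Mathlib

open CategoryTheory CategoryTheory.Limits Opposite

universe u

/-! Everything takes place inside the Grothendieck topos `Sheaf J (Type u)` of sheaves on a small
site `(C, J)`; its objects are the sets (discrete spaces).  Internal statements are spelled out on
sections by the Kripke-Joyal (sheaf) semantics. -/

namespace InternalLocale

section Families

variable {C : Type u} [SmallCategory C]

/-- A family of elements of a presheaf `P` over the stage `U`: a subpresheaf of `P` restricted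
to the slice over `U`. -/
@[ext]
structure SubFamily (P : Cᵒᵖ ⥤ Type u) (U : C) where
  /-- The elements lying over `f : V ⟶ U`. -/
  carrier : ∀ ⦃V : C⦄, (V ⟶ U) → Set (P.obj (op V))
  restrict : ∀ ⦃V : C⦄ (f : V ⟶ U) (x : P.obj (op V)), x ∈ carrier f →
    ∀ ⦃W : C⦄ (g : W ⟶ V), P.map g.op x ∈ carrier (g ≫ f)

/-- A family that is moreover local for the topology: when `P` is a sheaf this is a subsheaf of `P`
restricted to the slice over `U`, that is, a section over `U` of the power sheaf of `P`. -/
@[ext]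
structure LocalFamily (J : GrothendieckTopology C) (P : Cᵒᵖ ⥤ Type u) (U : C) extends
    SubFamily P U where
  isLocal : ∀ ⦃V : C⦄ (f : V ⟶ U) (x : P.obj (op V)) (S : Sieve V), S ∈ J V →
    (∀ ⦃W : C⦄ (g : W ⟶ V), S g → P.map g.op x ∈ carrier (g ≫ f)) → x ∈ carrier f

namespace LocalFamily

variable {J : GrothendieckTopology C} {P : Cᵒᵖ ⥤ Type u} {U : C}

theorem ext_mem {S T : LocalFamily J P U}
    (h : ∀ ⦃V : C⦄ (f : V ⟶ U) (x : P.obj (op V)), x ∈ S.carrier f ↔ x ∈ T.carrier f) : S = T := by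
  apply LocalFamily.ext
  funext V f
  ext x
  exact h f x

/-- Families are ordered by inclusion. -/
instance : PartialOrder (LocalFamily J P U) where
  le S T := ∀ ⦃V : C⦄ (f : V ⟶ U) (x : P.obj (op V)), x ∈ S.carrier f → x ∈ T.carrier f
  le_refl _ _ _ _ h := h
  le_trans _ _ _ h h' _ f x hx := h' f x (h f x hx)
  le_antisymm _ _ h h' := ext_mem fun _ f x => ⟨h f x, h' f x⟩

theorem le_iff {S T : LocalFamily J P U} : S ≤ T ↔
    ∀ ⦃V : C⦄ (f : V ⟶ U) (x : P.obj (op V)), x ∈ S.carrier f → x ∈ T.carrier f := Iff.rfl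

/-- Restriction of a family along `h : U' ⟶ U`. -/
def pull {U' : C} (h : U' ⟶ U) (S : LocalFamily J P U) : LocalFamily J P U' where
  carrier _ f := S.carrier (f ≫ h)
  restrict _ f x hx _ g := by
    simpa using S.restrict (f ≫ h) x hx g
  isLocal _ f x R hR hx := S.isLocal (f ≫ h) x R hR fun _ g hg => by
    simpa using hx g hg

theorem mem_pull {U' V : C} (h : U' ⟶ U) (S : LocalFamily J P U) (f : V ⟶ U')
    (x : P.obj (op V)) : x ∈ (S.pull h).carrier f ↔ x ∈ S.carrier (f ≫ h) := Iff.rfl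

/-- The local family generated by a family. -/
def closure (S : SubFamily P U) : LocalFamily J P U where
  carrier V f := {x | ∃ R ∈ J V, ∀ ⦃W : C⦄ (g : W ⟶ V), R g →
    P.map g.op x ∈ S.carrier (g ≫ f)}
  restrict := by
    rintro V f x ⟨R, hR, hx⟩ W g
    refine ⟨R.pullback g, J.pullback_stable g hR, fun W' g' hg' => ?_⟩
    have := hx (g' ≫ g) hg'
    simpa using this
  isLocal := by
    intro V f x R hR hx
    refine ⟨_, J.bind_covering (S := R)
      (R := fun W g hg => Classical.choose (hx g hg)) hR
      (fun W g hg => (Classical.choose_spec (hx g hg)).1), ?_⟩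
    rintro W g ⟨W', k, g', hg', hk, rfl⟩
    have := (Classical.choose_spec (hx g' hg')).2 k hk
    simpa using this

theorem mem_closure {S : SubFamily P U} {V : C} {f : V ⟶ U} {x : P.obj (op V)} :
    x ∈ (closure (J := J) S).carrier f ↔ ∃ R ∈ J V, ∀ ⦃W : C⦄ (g : W ⟶ V), R g →
      P.map g.op x ∈ S.carrier (g ≫ f) := Iff.rfl

theorem subset_closure {S : SubFamily P U} {V : C} {f : V ⟶ U} {x : P.obj (op V)}
    (hx : x ∈ S.carrier f) : x ∈ (closure (J := J) S).carrier f :=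
  ⟨⊤, J.top_mem V, fun _ g _ => S.restrict f x hx g⟩

theorem closure_le {S : SubFamily P U} {T : LocalFamily J P U}
    (h : ∀ ⦃V : C⦄ (f : V ⟶ U) (x : P.obj (op V)), x ∈ S.carrier f → x ∈ T.carrier f) :
    closure S ≤ T := by
  rintro V f x ⟨R, hR, hx⟩
  exact T.isLocal f x R hR fun W g hg => h _ _ (hx g hg)

/-- The union of a set of families. -/
def union (s : Set (LocalFamily J P U)) : SubFamily P U where
  carrier _ f := {x | ∃ S ∈ s, x ∈ S.carrier f}
  restrict := by
    rintro V f x ⟨S, hS, hx⟩ W g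
    exact ⟨S, hS, S.restrict f x hx g⟩

/-- Meets are intersections, joins are the local families generated by unions. -/
instance : CompleteLattice (LocalFamily J P U) where
  inf S T :=
    { carrier := fun _ f => S.carrier f ∩ T.carrier f
      restrict := fun _ f x hx _ g => ⟨S.restrict f x hx.1 g, T.restrict f x hx.2 g⟩
      isLocal := fun _ f x R hR hx => ⟨S.isLocal f x R hR fun _ g hg => (hx g hg).1,
        T.isLocal f x R hR fun _ g hg => (hx g hg).2⟩ }
  inf_le_left _ _ _ _ _ h := h.1
  inf_le_right _ _ _ _ _ h := h.2
  le_inf _ _ _ h h' _ f x hx := ⟨h f x hx, h' f x hx⟩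
  sup S T := closure (union {S, T})
  le_sup_left S T _ f x hx := subset_closure ⟨S, by simp, hx⟩
  le_sup_right S T _ f x hx := subset_closure ⟨T, by simp, hx⟩
  sup_le S T R h h' := closure_le <| by
    rintro V f x ⟨Q, hQ, hx⟩
    rcases hQ with rfl | rfl
    · exact h f x hx
    · exact h' f x hx
  sSup s := closure (union s)
  isLUB_sSup s := ⟨fun S hS _ f x hx => subset_closure ⟨S, hS, hx⟩, fun T hT => closure_le <| by
    rintro V f x ⟨Q, hQ, hx⟩
    exact hT hQ f x hx⟩
  sInf s :=
    { carrier := fun _ f => {x | ∀ S ∈ s, x ∈ S.carrier f}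
      restrict := fun _ f x hx _ g S hS => S.restrict f x (hx S hS) g
      isLocal := fun _ f x R hR hx S hS => S.isLocal f x R hR fun _ g hg => hx g hg S hS }
  isGLB_sInf s := ⟨fun S hS _ f x hx => hx S hS, fun T hT _ f x hx S hS => hT hS f x hx⟩
  top :=
    { carrier := fun _ _ => Set.univ
      restrict := fun _ _ _ _ _ _ => trivial
      isLocal := fun _ _ _ _ _ _ => trivial }
  le_top _ _ _ _ _ := trivial
  bot := closure
    { carrier := fun _ _ => ∅
      restrict := fun _ _ _ h => h.elim }
  bot_le _ := closure_le fun _ _ _ h => h.elim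

theorem mem_inf {S T : LocalFamily J P U} {V : C} {f : V ⟶ U} {x : P.obj (op V)} :
    x ∈ (S ⊓ T).carrier f ↔ x ∈ S.carrier f ∧ x ∈ T.carrier f := Iff.rfl

theorem mem_top {V : C} {f : V ⟶ U} {x : P.obj (op V)} :
    x ∈ (⊤ : LocalFamily J P U).carrier f := trivial

theorem mem_sSup {s : Set (LocalFamily J P U)} {V : C} {f : V ⟶ U} {x : P.obj (op V)} :
    x ∈ (sSup s).carrier f ↔ ∃ R ∈ J V, ∀ ⦃W : C⦄ (g : W ⟶ V), R g →
      ∃ S ∈ s, P.map g.op x ∈ S.carrier (g ≫ f) := Iff.rfl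

instance : Order.Frame (LocalFamily J P U) := Order.Frame.ofMinimalAxioms
  { inf_sSup_le_iSup_inf := by
      rintro T s V f x ⟨hT, R, hR, hx⟩
      refine LocalFamily.isLocal _ f x R hR fun W g hg => ?_
      obtain ⟨S, hS, hxS⟩ := hx g hg
      have h : T ⊓ S ≤ ⨆ b ∈ s, T ⊓ b := le_iSup₂_of_le S hS le_rfl
      exact h _ _ ⟨T.restrict f x hT g, hxS⟩ }

/-- Restriction is a frame homomorphism. -/
def pullHom {U' : C} (h : U' ⟶ U) : FrameHom (LocalFamily J P U) (LocalFamily J P U') where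
  toFun := pull h
  map_inf' _ _ := rfl
  map_top' := rfl
  map_sSup' s := by
    refine ext_mem fun V f x => ?_
    rw [mem_pull, mem_sSup, mem_sSup]
    simp [mem_pull]

end LocalFamily

end Families

variable {C : Type u} [SmallCategory C] {J : GrothendieckTopology C}

section Frames

/-- `s` is the join over `U` of the family `Φ` of elements of `L`, in the internal logic: at every
later stage, the upper bounds of `Φ` are the elements above `s`. -/
def IsJoin (L : Cᵒᵖ ⥤ Frm.{u}) {U : C} (Φ : SubFamily (L ⋙ forget Frm) U)
    (s : L.obj (op U)) : Prop :=
  ∀ ⦃V : C⦄ (f : V ⟶ U) (b : L.obj (op V)),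
    L.map f.op s ≤ b ↔
      ∀ ⦃W : C⦄ (g : W ⟶ V) (a : L.obj (op W)), a ∈ Φ.carrier (g ≫ f) → a ≤ L.map g.op b

/-- The family of all `a ⊓ t` with `a` in `Φ`. -/
def infFamily (L : Cᵒᵖ ⥤ Frm.{u}) {U : C} (Φ : SubFamily (L ⋙ forget Frm) U)
    (t : L.obj (op U)) : SubFamily (L ⋙ forget Frm) U where
  carrier V f := {c | ∃ a : L.obj (op V), a ∈ Φ.carrier f ∧ c = a ⊓ L.map f.op t}
  restrict := by
    rintro V f _ ⟨a, ha, rfl⟩ W g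
    refine ⟨L.map g.op a, Φ.restrict f a ha g, ?_⟩
    simp

/-- The image of a family under a natural family of frame homomorphisms. -/
def imageFamily {L M : Cᵒᵖ ⥤ Frm.{u}} (φ : L ⟶ M) {U : C} (Φ : SubFamily (L ⋙ forget Frm) U) :
    SubFamily (M ⋙ forget Frm) U where
  carrier V f := {c | ∃ a : L.obj (op V), a ∈ Φ.carrier f ∧ c = φ.app (op V) a}
  restrict := by
    rintro V f _ ⟨a, ha, rfl⟩ W g
    refine ⟨L.map g.op a, Φ.restrict f a ha g, ?_⟩
    exact (NatTrans.naturality_apply φ g.op a).symm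

variable (J) in
/-- An internal frame of `Sheaf J (Type u)`: an internal poset with finite meets and with joins of
all internal families of elements, over which binary meets distribute.  (The sections of such an
object over any stage form a frame, and restrictions are frame homomorphisms, since the external
joins are the internal joins of constant families; so nothing is lost by starting from a
presheaf with values in `Frm`.) -/
structure IFrame where
  /-- The sections. -/
  obj : Cᵒᵖ ⥤ Frm.{u}
  isSheaf : Presieve.IsSheaf J (obj ⋙ forget Frm)
  exists_isJoin : ∀ {U : C} (Φ : SubFamily (obj ⋙ forget Frm) U), ∃ s, IsJoin obj Φ s
  inf_isJoin : ∀ {U : C} (Φ : SubFamily (obj ⋙ forget Frm) U) (s t : obj.obj (op U)),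
    IsJoin obj Φ s → IsJoin obj (infFamily obj Φ t) (s ⊓ t)

/-- An internal frame homomorphism: it preserves finite meets and all internal joins. -/
@[ext]
structure IFrame.Hom (L M : IFrame J) where
  /-- The natural transformation. -/
  hom : L.obj ⟶ M.obj
  isJoin : ∀ {U : C} (Φ : SubFamily (L.obj ⋙ forget Frm) U) (s : L.obj.obj (op U)),
    IsJoin L.obj Φ s → IsJoin M.obj (imageFamily hom Φ) (hom.app (op U) s)

instance : Category (IFrame J) where
  Hom L M := IFrame.Hom L M
  id L := ⟨𝟙 L.obj, fun Φ s h => by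
    have : imageFamily (𝟙 L.obj) Φ = Φ := by
      apply SubFamily.ext
      funext V f
      ext c
      simp [imageFamily]
    rw [this]
    simpa using h⟩
  comp φ ψ := ⟨φ.hom ≫ ψ.hom, fun Φ s h => by
    have : imageFamily (φ.hom ≫ ψ.hom) Φ = imageFamily ψ.hom (imageFamily φ.hom Φ) := by
      apply SubFamily.ext
      funext V f
      ext c
      simp [imageFamily]
    rw [this]
    simpa using ψ.isJoin _ _ (φ.isJoin _ _ h)⟩
  id_comp _ := IFrame.Hom.ext (Category.id_comp _)
  comp_id _ := IFrame.Hom.ext (Category.comp_id _)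
  assoc _ _ _ := IFrame.Hom.ext (Category.assoc _ _ _)

variable (J) in
/-- The category of internal locales (localic spaces) of `Sheaf J (Type u)`. -/
abbrev ILocale := (IFrame J)ᵒᵖ

/-- The frame of opens of an internal locale. -/
abbrev opens (Z : ILocale J) : Cᵒᵖ ⥤ Frm.{u} := Z.unop.obj

/-- The inverse image of an open under a map of internal locales. -/
abbrev preim {Z W : ILocale J} (φ : Z ⟶ W) {U : C} (a : (opens W).obj (op U)) :
    (opens Z).obj (op U) := IFrame.Hom.hom φ.unop |>.app (op U) a

end Frames

section Discrete

variable (J) in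
/-- The presheaf of local families of elements of `P`, as a presheaf of frames. -/
def powerFrm (P : Cᵒᵖ ⥤ Type u) : Cᵒᵖ ⥤ Frm.{u} where
  obj U := Frm.of (LocalFamily J P U.unop)
  map h := Frm.ofHom (LocalFamily.pullHom h.unop)
  map_id U := by
    apply Frm.hom_ext
    refine DFunLike.ext _ _ fun (S : LocalFamily J P U.unop) => ?_
    refine LocalFamily.ext_mem fun V f x => ?_
    change x ∈ S.carrier (f ≫ 𝟙 _) ↔ x ∈ S.carrier f
    rw [Category.comp_id]
  map_comp {U _ _} h k := by
    apply Frm.hom_ext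
    refine DFunLike.ext _ _ fun (S : LocalFamily J P U.unop) => ?_
    refine LocalFamily.ext_mem fun V f x => ?_
    change x ∈ S.carrier (f ≫ k.unop ≫ h.unop) ↔ x ∈ S.carrier ((f ≫ k.unop) ≫ h.unop)
    rw [Category.assoc]

theorem powerFrm_map (P : Cᵒᵖ ⥤ Type u) {U V : C} (h : V ⟶ U) (S : LocalFamily J P U) :
    (powerFrm J P).map h.op S = S.pull h := rfl

theorem powerFrm_isSheaf (P : Cᵒᵖ ⥤ Type u) :
    Presieve.IsSheaf J (powerFrm J P ⋙ forget Frm) := by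
  intro U R hR x hx
  rw [Presieve.compatible_iff_sieveCompatible] at hx
  let y : ∀ ⦃V : C⦄ (f : V ⟶ U), R f → LocalFamily J P V := fun V f h => x f h
  have hy : ∀ ⦃V W : C⦄ (f : V ⟶ U) (g : W ⟶ V) (h : R f),
      y (g ≫ f) (R.downward_closed h g) = (y f h).pull g := fun V W f g h => hx f g h
  let S : SubFamily P U :=
    { carrier := fun V f => {z | ∃ h : R f, z ∈ (y f h).carrier (𝟙 V)}
      restrict := by
        rintro V f z ⟨h, hz⟩ W g
        refine ⟨R.downward_closed h g, ?_⟩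
        rw [hy f g h, LocalFamily.mem_pull]
        have := (y f h).restrict (𝟙 V) z hz g
        simpa using this }
  refine ⟨(LocalFamily.closure S : LocalFamily J P U), ?_, ?_⟩
  · intro V f h
    change (LocalFamily.closure S : LocalFamily J P U).pull f = y f h
    refine LocalFamily.ext_mem fun W k z => ?_
    have key : ∀ ⦃W' : C⦄ (g : W' ⟶ W), (∃ h' : R (g ≫ k ≫ f),
        P.map g.op z ∈ (y (g ≫ k ≫ f) h').carrier (𝟙 W')) ↔
          P.map g.op z ∈ (y f h).carrier (g ≫ k) := by
      intro W' g
      have h2 : R ((g ≫ k) ≫ f) := R.downward_closed h _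
      have h3 := hy f (g ≫ k) h
      have h4 : ∀ h', y (g ≫ k ≫ f) h' = (y f h).pull (g ≫ k) := by
        intro h'
        rw [← h3]
        congr 1
        simp
      constructor
      · rintro ⟨h', hz⟩
        rw [h4, LocalFamily.mem_pull] at hz
        simpa using hz
      · intro hz
        refine ⟨by simpa using h2, ?_⟩
        rw [h4, LocalFamily.mem_pull]
        simpa using hz
    constructor
    · rintro ⟨Q, hQ, hz⟩
      exact (y f h).isLocal k z Q hQ fun W' g hg => (key g).1 (hz g hg)
    · intro hz
      exact ⟨⊤, J.top_mem _, fun W' g _ => (key g).2 ((y f h).restrict k z hz g)⟩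
  · intro T hT
    change LocalFamily J P U at T
    have hT' : ∀ ⦃V : C⦄ (f : V ⟶ U) (h : R f), T.pull f = y f h := fun V f h => hT f h
    refine LocalFamily.ext_mem fun V f z => ?_
    constructor
    · intro hz
      refine ⟨R.pullback f, J.pullback_stable f hR, fun W g hg => ⟨hg, ?_⟩⟩
      rw [← hT' _ hg, LocalFamily.mem_pull]
      simpa using T.restrict f z hz g
    · rintro ⟨Q, hQ, hz⟩
      refine T.isLocal f z Q hQ fun W g hg => ?_
      obtain ⟨h', hz'⟩ := hz g hg
      rw [← hT' _ h', LocalFamily.mem_pull] at hz'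
      simpa using hz'

/-- The union of an internal family of subsheaves. -/
def unionFamily (P : Cᵒᵖ ⥤ Type u) {U : C} (Φ : SubFamily (powerFrm J P ⋙ forget Frm) U) :
    SubFamily P U where
  carrier V f := {x | ∃ T : LocalFamily J P V, T ∈ Φ.carrier f ∧ x ∈ T.carrier (𝟙 V)}
  restrict := by
    rintro V f x ⟨T, hT, hx⟩ W g
    refine ⟨T.pull g, Φ.restrict f T hT g, ?_⟩
    rw [LocalFamily.mem_pull]
    simpa using T.restrict (𝟙 V) x hx g

theorem isJoin_unionFamily (P : Cᵒᵖ ⥤ Type u) {U : C}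
    (Φ : SubFamily (powerFrm J P ⋙ forget Frm) U) :
    IsJoin (powerFrm J P) Φ (LocalFamily.closure (unionFamily P Φ) : LocalFamily J P U) := by
  intro V f b
  change LocalFamily J P V at b
  change (LocalFamily.closure (unionFamily P Φ) : LocalFamily J P U).pull f ≤ b ↔
    ∀ ⦃W : C⦄ (g : W ⟶ V) (a : LocalFamily J P W), a ∈ Φ.carrier (g ≫ f) → a ≤ b.pull g
  constructor
  · intro h W g a ha W' k x hx
    rw [LocalFamily.mem_pull]
    refine h _ _ ?_
    rw [LocalFamily.mem_pull]
    refine LocalFamily.subset_closure ⟨a.pull k, ?_, ?_⟩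
    · have := Φ.restrict (g ≫ f) a ha k
      rw [Category.assoc]
      exact this
    · rw [LocalFamily.mem_pull]
      simpa using hx
  · rintro h W k x ⟨R, hR, hx⟩
    refine b.isLocal k x R hR fun W' g hg => ?_
    obtain ⟨T, hT, hxT⟩ := hx g hg
    have := h (g ≫ k) T (by simpa using hT) (𝟙 _) _ hxT
    rw [LocalFamily.mem_pull] at this
    simpa using this

theorem IsJoin.unique {L : Cᵒᵖ ⥤ Frm.{u}} {U : C} {Φ : SubFamily (L ⋙ forget Frm) U}
    {s t : L.obj (op U)} (hs : IsJoin L Φ s) (ht : IsJoin L Φ t) : s = t := by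
  have h : ∀ b : L.obj (op U), s ≤ b ↔ t ≤ b := by
    intro b
    have h1 := hs (𝟙 U) b
    have h2 := ht (𝟙 U) b
    simp only [op_id, CategoryTheory.Functor.map_id] at h1 h2
    exact h1.trans h2.symm
  exact le_antisymm ((h t).2 le_rfl) ((h s).1 le_rfl)

/-- The power object of a sheaf, as an internal frame. -/
def power (X : Sheaf J (Type u)) : IFrame J where
  obj := powerFrm J X.obj
  isSheaf := powerFrm_isSheaf X.obj
  exists_isJoin Φ := ⟨_, isJoin_unionFamily X.obj Φ⟩
  inf_isJoin {U} Φ s t h := by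
    rw [h.unique (isJoin_unionFamily X.obj Φ)]
    have key : (LocalFamily.closure (unionFamily X.obj Φ) : LocalFamily J X.obj U) ⊓ t =
        LocalFamily.closure (unionFamily X.obj (infFamily (powerFrm J X.obj) Φ t)) := by
      change LocalFamily J X.obj U at t
      refine LocalFamily.ext_mem fun V f x => ?_
      constructor
      · rintro ⟨⟨R, hR, hx⟩, hxt⟩
        refine ⟨R, hR, fun W g hg => ?_⟩
        obtain ⟨T, hT, hxT⟩ := hx g hg
        refine ⟨T ⊓ t.pull (g ≫ f), ⟨T, hT, rfl⟩, hxT, ?_⟩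
        rw [LocalFamily.mem_pull]
        simpa using t.restrict f x hxt g
      · rintro ⟨R, hR, hx⟩
        refine ⟨⟨R, hR, fun W g hg => ?_⟩, t.isLocal f x R hR fun W g hg => ?_⟩
        · obtain ⟨_, ⟨T, hT, rfl⟩, hxT⟩ := hx g hg
          exact ⟨T, hT, hxT.1⟩
        · obtain ⟨_, ⟨T, hT, rfl⟩, hxT⟩ := hx g hg
          have : X.obj.map g.op x ∈ t.carrier (𝟙 _ ≫ g ≫ f) := hxT.2
          simpa using this
    have := isJoin_unionFamily X.obj (infFamily (powerFrm J X.obj) Φ t)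
    rw [← key] at this
    exact this

/-- A set (sheaf) `X` as a discrete space: its opens are the subsheaves. -/
def discrete (X : Sheaf J (Type u)) : ILocale J := op (power X)

/-- The open point `{x}` of the discrete space `X`, for `x` an element of `X` over `U`. -/
def point (X : Sheaf J (Type u)) {U : C} (x : X.obj.obj (op U)) :
    (opens (discrete X)).obj (op U) := show LocalFamily J X.obj U from
  { carrier := fun _ f => {X.obj.map f.op x}
    restrict := by
      rintro V f _ rfl W g
      simp
    isLocal := by
      intro V f z R hR h
      have hs := (isSheaf_iff_isSheaf_of_type J X.obj).1 X.property
      refine (hs R hR).isSeparatedFor.ext fun W g hg => ?_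
      have h' : X.obj.map g.op z = X.obj.map (g ≫ f).op x := h g hg
      rw [h']
      simp }

end Discrete

section Boolean

variable (J) in
/-- An internal Boolean algebra of `Sheaf J (Type u)`: a sheaf of Boolean algebras. -/
structure IBool where
  /-- The sections. -/
  obj : Cᵒᵖ ⥤ BoolAlg.{u}
  isSheaf : Presieve.IsSheaf J (obj ⋙ forget BoolAlg)

/-- The internal ideals of `A` over the stage `U`: the sections over `U` of `Idl A`. -/
def Idl (A : IBool J) (U : C) : Type u :=
  {I : LocalFamily J (A.obj ⋙ forget BoolAlg) U // ∀ ⦃V : C⦄ (f : V ⟶ U),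
    (⊥ : A.obj.obj (op V)) ∈ I.carrier f ∧
    (∀ a b : A.obj.obj (op V), a ≤ b → b ∈ I.carrier f → a ∈ I.carrier f) ∧
    ∀ a b : A.obj.obj (op V), a ∈ I.carrier f → b ∈ I.carrier f → a ⊔ b ∈ I.carrier f}

instance (A : IBool J) (U : C) : PartialOrder (Idl A U) := Subtype.partialOrder _

/-- Restriction of internal ideals. -/
def Idl.pull {A : IBool J} {U V : C} (h : V ⟶ U) (I : Idl A U) : Idl A V :=
  ⟨I.1.pull h, fun _ f => I.2 (f ≫ h)⟩

/-- `Z` is a Stone space: it is the spectrum of some internal Boolean algebra `A`, that is,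
its internal frame of opens is isomorphic to the ideal completion of `A`. -/
def IsStone (Z : ILocale J) : Prop :=
  ∃ (A : IBool J) (e : ∀ U : C, (opens Z).obj (op U) ≃o Idl A U),
    ∀ ⦃U V : C⦄ (h : V ⟶ U) (a : (opens Z).obj (op U)),
      e V ((opens Z).map h.op a) = (e U a).pull h

noncomputable instance (L : Type u) [Order.Frame L] : BooleanAlgebra (Complementeds L) :=
  DistribLattice.booleanAlgebraOfComplemented _

/-- A frame homomorphism restricts to the complemented elements. -/
def complMap {L M : Type u} [Order.Frame L] [Order.Frame M] (φ : FrameHom L M) :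
    BoundedLatticeHom (Complementeds L) (Complementeds M) where
  toFun a := ⟨φ a.1, by
    obtain ⟨b, hb⟩ := a.2
    exact ⟨φ b, hb.map φ⟩⟩
  map_sup' a b := Subtype.ext (map_sup φ a.1 b.1)
  map_inf' a b := Subtype.ext (map_inf φ a.1 b.1)
  map_top' := Subtype.ext (map_top φ)
  map_bot' := Subtype.ext (map_bot φ)

/-- The clopens of `Z` over each stage: the complemented opens. -/
noncomputable def clopFunctor (Z : ILocale J) : Cᵒᵖ ⥤ BoolAlg.{u} where
  obj U := BoolAlg.of (Complementeds ((opens Z).obj U))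
  map h := BoolAlg.ofHom (complMap ((opens Z).map h).hom)
  map_id U := by
    apply BoolAlg.hom_ext
    refine DFunLike.ext _ _ fun (a : Complementeds ((opens Z).obj U)) => ?_
    apply Subtype.ext
    change (opens Z).map (𝟙 U) a.1 = a.1
    simp
  map_comp {U _ _} h k := by
    apply BoolAlg.hom_ext
    refine DFunLike.ext _ _ fun (a : Complementeds ((opens Z).obj U)) => ?_
    apply Subtype.ext
    change (opens Z).map (h ≫ k) a.1 = (opens Z).map k ((opens Z).map h a.1)
    simp

theorem clopFunctor_isSheaf (Z : ILocale J) :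
    Presieve.IsSheaf J (clopFunctor Z ⋙ forget BoolAlg) := by
  intro U R hR x hx
  rw [Presieve.compatible_iff_sieveCompatible] at hx
  have hZ := Z.unop.isSheaf R hR
  let y : ∀ ⦃V : C⦄ (f : V ⟶ U), R f → Complementeds ((opens Z).obj (op V)) := fun V f h => x f h
  have hy : ∀ ⦃V W : C⦄ (f : V ⟶ U) (g : W ⟶ V) (h : R f),
      (y (g ≫ f) (R.downward_closed h g)).1 = (opens Z).map g.op (y f h).1 :=
    fun V W f g h => congrArg Subtype.val (hx f g h)
  let y' : Presieve.FamilyOfElements (opens Z ⋙ forget Frm) R.arrows := fun V f h => (y f h).1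
  let z' : Presieve.FamilyOfElements (opens Z ⋙ forget Frm) R.arrows :=
    fun V f h => ((y f h)ᶜ).1
  have hcompl : ∀ ⦃V : C⦄ (f : V ⟶ U) (h : R f), IsCompl (y f h).1 ((y f h)ᶜ).1 := by
    intro V f h
    have h1 : IsCompl (y f h) (y f h)ᶜ := isCompl_compl
    rw [Complementeds.isCompl_coe]
    exact h1
  have hy' : y'.Compatible := by
    rw [Presieve.compatible_iff_sieveCompatible]
    exact fun V W f g h => hy f g h
  have hz' : z'.Compatible := by
    rw [Presieve.compatible_iff_sieveCompatible]
    intro V W f g h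
    have h1 := hcompl (g ≫ f) (R.downward_closed h g)
    have h2 := (hcompl f h).map ((opens Z).map g.op).hom
    have h3 : IsCompl (y (g ≫ f) (R.downward_closed h g)).1
      ((opens Z).map g.op ((y f h)ᶜ).1) := by
      rw [hy f g h]
      exact h2
    exact h1.right_unique h3
  obtain ⟨a, ha, ha'⟩ := hZ y' hy'
  obtain ⟨b, hb, -⟩ := hZ z' hz'
  change (opens Z).obj (op U) at a b
  have ha1 : ∀ ⦃V : C⦄ (f : V ⟶ U) (h : R f), (opens Z).map f.op a = (y f h).1 := ha
  have hb1 : ∀ ⦃V : C⦄ (f : V ⟶ U) (h : R f), (opens Z).map f.op b = ((y f h)ᶜ).1 := hb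
  have sep : ∀ c d : (opens Z).obj (op U),
      (∀ ⦃V : C⦄ (f : V ⟶ U), R f → (opens Z).map f.op c = (opens Z).map f.op d) → c = d :=
    fun c d h => hZ.isSeparatedFor.ext fun V f hf => h f hf
  have hab : IsCompl a b := by
    apply IsCompl.of_eq
    · refine sep _ _ fun V f h => ?_
      rw [map_inf, map_bot, ha1 f h, hb1 f h, (hcompl f h).inf_eq_bot]
    · refine sep _ _ fun V f h => ?_
      rw [map_sup, map_top, ha1 f h, hb1 f h, (hcompl f h).sup_eq_top]
  refine ⟨(⟨a, b, hab⟩ : Complementeds ((opens Z).obj (op U))), ?_, ?_⟩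
  · intro V f h
    exact Subtype.ext (ha1 f h)
  · intro c hc
    change Complementeds ((opens Z).obj (op U)) at c
    apply Subtype.ext
    exact ha' c.1 fun V f h => congrArg Subtype.val (hc f h)

/-- The internal Boolean algebra of clopens of `Z`. -/
noncomputable def Clop (Z : ILocale J) : IBool J where
  obj := clopFunctor Z
  isSheaf := clopFunctor_isSheaf Z

/-- The open underlying a clopen. -/
def Clop.toOpen {Z : ILocale J} {U : C} (a : (Clop Z).obj.obj (op U)) :
    (opens Z).obj (op U) := Subtype.val (p := IsComplemented) a

/-- Elements `(x, y)` of an internal Boolean algebra, indexed by the set `X × Y`. -/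
abbrev Generators (X Y : Sheaf J (Type u)) (B : IBool J) :=
  FunctorToTypes.prod X.obj Y.obj ⟶ B.obj ⋙ forget BoolAlg

/-- The element `(x, y)`. -/
def Generators.elt {X Y : Sheaf J (Type u)} {B : IBool J} (γ : Generators X Y B) {U : C}
    (x : X.obj.obj (op U)) (y : Y.obj.obj (op U)) : B.obj.obj (op U) :=
  γ.app (op U) (x, y)

/-- The relations `1 ≤ ⋁ y, (x, y)` and `(x, y) ∧ (x, y') ≤ 0` for `y ≠ y'`, in the internal logic.
The first says that `1` is below every upper bound of the `(x, y)`, where `y` ranges over the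
elements of `Y` at all later stages.  In the second, `y ≠ y'` over `U` means that any stage over
`U` at which `y` and `y'` become equal is covered by the empty family. -/
structure SatisfiesRelations {X Y : Sheaf J (Type u)} {B : IBool J} (γ : Generators X Y B) :
    Prop where
  total : ∀ ⦃U : C⦄ (x : X.obj.obj (op U)) (b : B.obj.obj (op U)),
    (∀ ⦃V : C⦄ (f : V ⟶ U) (y : Y.obj.obj (op V)),
      γ.elt (X.obj.map f.op x) y ≤ B.obj.map f.op b) → ⊤ ≤ b
  single : ∀ ⦃U : C⦄ (x : X.obj.obj (op U)) (y y' : Y.obj.obj (op U)),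
    (∀ ⦃V : C⦄ (f : V ⟶ U), Y.obj.map f.op y = Y.obj.map f.op y' → ⊥ ∈ J V) →
      γ.elt x y ⊓ γ.elt x y' ≤ ⊥

/-- `B` is generated by the elements `(x, y)` subject to the above relations: it is universal among
internal Boolean algebras with such elements. -/
structure IsPresentedBy {X Y : Sheaf J (Type u)} {B : IBool J} (γ : Generators X Y B) :
    Prop where
  relations : SatisfiesRelations γ
  universal : ∀ (A : IBool J) (δ : Generators X Y A), SatisfiesRelations δ →
    ∃! φ : B.obj ⟶ A.obj, ∀ ⦃U : C⦄ (x : X.obj.obj (op U)) (y : Y.obj.obj (op U)),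
      φ.app (op U) (γ.elt x y) = δ.elt x y

end Boolean

/-- `W`, with the evaluation map `ev : W × X ⟶ Y` on the product `p` of `W` and `X`, is the
exponential `Y ^ X` in `D`, where all products with `X` exist. -/
structure IsExponential {D : Type*} [Category D] {X Y W : D} (p : BinaryFan W X)
    (hp : IsLimit p) (ev : p.pt ⟶ Y) : Prop where
  hasProducts : ∀ Z : D, HasBinaryProduct Z X
  universal : ∀ (Z : D) (q : BinaryFan Z X), IsLimit q → ∀ g : q.pt ⟶ Y,
    ∃! h : Z ⟶ W, hp.lift (BinaryFan.mk (q.fst ≫ h) q.snd) ≫ ev = g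

end InternalLocale

/-! A Stone space is compact and its opens are joins of clopens; for the discrete space `Y` this
says that `Y` is decidable and finite in the internal logic. The frame of `Z × X` with `X`
discrete is the power of the frame of `Z` by `X`, so a map `Z × X ⟶ Y` amounts to a relation
between `X` and `Y`, with values in the frame of `Z`, which is total and single-valued. The frame
of `Y ^ X` is therefore freely generated by symbols `(x, y)` subject to these two conditions. We
represent an open by the finite sets of symbols, read as their meets, that lie below it.

Let `δ` interpret the symbols in a Boolean algebra `A`. As `Y` is finite and decidable, totality
only involves finite joins, so for every ideal `I` of `A` the words with value in `I` form an open
of `Y ^ X`, and this open is the whole space only if `1 ∈ I`. When `A` is the algebra of clopens,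
this identifies ideals with opens, so `Y ^ X` is Stone. In general, the value at a clopen `c` of
the extension of `δ` is the unique `a` such that `c` lies below the open of `a` and the complement
of `c` below the open of the complement of `a`. The elements of `A` on which such a value exists
form an ideal whose open contains both `c` and its complement; hence `1` belongs to it. -/

namespace InternalLocale

theorem IsExponential.of_isLimit {D : Type*} [Category D] {X Y W : D} (fan : ∀ Z, BinaryFan Z X)
    (lim : ∀ Z, IsLimit (fan Z)) (ev : (fan W).pt ⟶ Y)
    (exists_unique : ∀ (Z : D) (g : (fan Z).pt ⟶ Y),
      ∃! h : Z ⟶ W, (lim W).lift (BinaryFan.mk ((fan Z).fst ≫ h) (fan Z).snd) ≫ ev = g) :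
    IsExponential (fan W) (lim W) ev where
  hasProducts Z := ⟨⟨⟨_, lim Z⟩⟩⟩
  universal Z q hq g := by
    let i := (lim Z).conePointUniqueUpToIso hq
    have i_fst : i.hom ≫ q.fst = (fan Z).fst :=
      (lim Z).conePointUniqueUpToIso_hom_comp hq ⟨WalkingPair.left⟩
    have i_snd : i.hom ≫ q.snd = (fan Z).snd :=
      (lim Z).conePointUniqueUpToIso_hom_comp hq ⟨WalkingPair.right⟩
    have lift_fst : ∀ {T : D} (f : T ⟶ W) (g : T ⟶ X),
        (lim W).lift (BinaryFan.mk f g) ≫ (fan W).fst = f :=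
      BinaryFan.IsLimit.lift_fst (lim W)
    have lift_snd : ∀ {T : D} (f : T ⟶ W) (g : T ⟶ X),
        (lim W).lift (BinaryFan.mk f g) ≫ (fan W).snd = g :=
      BinaryFan.IsLimit.lift_snd (lim W)
    have comp_lift : ∀ h : Z ⟶ W, i.hom ≫ (lim W).lift (BinaryFan.mk (q.fst ≫ h) q.snd) =
        (lim W).lift (BinaryFan.mk ((fan Z).fst ≫ h) (fan Z).snd) := fun h =>
      BinaryFan.IsLimit.hom_ext (lim W)
        ((Category.assoc ..).trans <| (congrArg (i.hom ≫ ·) (lift_fst (q.fst ≫ h) q.snd)).trans <|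
          (Category.assoc ..).symm.trans <| (congrArg (· ≫ h) i_fst).trans (lift_fst _ _).symm)
        ((Category.assoc ..).trans <| (congrArg (i.hom ≫ ·) (lift_snd (q.fst ≫ h) q.snd)).trans <|
          i_snd.trans (lift_snd _ _).symm)
    have lift_comp_iff : ∀ h : Z ⟶ W,
        (lim W).lift (BinaryFan.mk ((fan Z).fst ≫ h) (fan Z).snd) ≫ ev = i.hom ≫ g ↔
          (lim W).lift (BinaryFan.mk (q.fst ≫ h) q.snd) ≫ ev = g := fun h => by
      rw [← cancel_epi i.hom, ← Category.assoc]
      exact iff_of_eq (congrArg (· ≫ ev = i.hom ≫ g) (comp_lift h).symm)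
    simpa only [lift_comp_iff] using exists_unique Z (i.hom ≫ g)

variable {C : Type u} [SmallCategory C] {J : GrothendieckTopology C}

theorem map_map {D : Type*} [Category D] {FD : D → D → Type*} {CD : D → Type*}
    [∀ A B, FunLike (FD A B) (CD A) (CD B)] [ConcreteCategory D FD] (F : Cᵒᵖ ⥤ D) {U V W : C}
    (f : V ⟶ U) (g : W ⟶ V) (x : ToType (F.obj (op U))) :
    F.map g.op (F.map f.op x) = F.map (g ≫ f).op x := by
  simp

theorem map_mono (L : Cᵒᵖ ⥤ Frm.{u}) {U V : C} (f : V ⟶ U) {a b : L.obj (op U)} (h : a ≤ b) :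
    L.map f.op a ≤ L.map f.op b :=
  OrderHomClass.mono (L.map f.op).hom h

namespace SubFamily

variable {P : Cᵒᵖ ⥤ Type u} {U V : C}

/-- Restriction of a family along `h : V ⟶ U`. -/
def pull (h : V ⟶ U) (S : SubFamily P U) : SubFamily P V where
  carrier _ f := S.carrier (f ≫ h)
  restrict _ f x hx _ g := by
    simpa using S.restrict (f ≫ h) x hx g

theorem ext_mem {S T : SubFamily P U}
    (h : ∀ ⦃V : C⦄ (f : V ⟶ U) (x : P.obj (op V)), x ∈ S.carrier f ↔ x ∈ T.carrier f) : S = T := by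
  ext V f x
  exact h f x

end SubFamily

namespace IsJoin

variable {L : Cᵒᵖ ⥤ Frm.{u}} {U V : C} {Φ : SubFamily (L ⋙ forget Frm) U} {s : L.obj (op U)}

theorem pull (h : IsJoin L Φ s) (f : V ⟶ U) : IsJoin L (Φ.pull f) (L.map f.op s) := by
  intro W g b
  rw [map_map, h (g ≫ f) b]
  simp only [SubFamily.pull, Category.assoc]

theorem le_iff (h : IsJoin L Φ s) {b : L.obj (op U)} : s ≤ b ↔
    ∀ ⦃V : C⦄ (f : V ⟶ U) (a : L.obj (op V)), a ∈ Φ.carrier f → a ≤ L.map f.op b := by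
  simpa using h (𝟙 U) b

theorem le (h : IsJoin L Φ s) {f : V ⟶ U} {a : L.obj (op V)} (ha : a ∈ Φ.carrier f) :
    a ≤ L.map f.op s :=
  h.le_iff.1 le_rfl f a ha

theorem of_le (h : ∀ ⦃V : C⦄ (f : V ⟶ U) (a : L.obj (op V)), a ∈ Φ.carrier f → a ≤ L.map f.op s)
    (h' : ∀ ⦃V : C⦄ (f : V ⟶ U) (b : L.obj (op V)),
      (∀ ⦃W : C⦄ (g : W ⟶ V) (a : L.obj (op W)), a ∈ Φ.carrier (g ≫ f) → a ≤ L.map g.op b) →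
        L.map f.op s ≤ b) : IsJoin L Φ s := by
  refine fun V f b => ⟨fun hb W g a ha => (h _ a ha).trans ?_, h' f b⟩
  rw [← map_map]
  exact map_mono L g hb

end IsJoin

/-- The restrictions of a set of sections, as an internal family. -/
def constFamily (L : Cᵒᵖ ⥤ Frm.{u}) {U : C} (s : Set (L.obj (op U))) :
    SubFamily (L ⋙ forget Frm) U where
  carrier _ f := L.map f.op '' s
  restrict := by
    rintro V f _ ⟨a, ha, rfl⟩ W g
    exact ⟨a, ha, (map_map L f g a).symm⟩

theorem isJoin_constFamily (L : Cᵒᵖ ⥤ Frm.{u}) {U : C} (s : Set (L.obj (op U))) :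
    IsJoin L (constFamily L s) (sSup s) := by
  refine .of_le ?_ fun V f b hb => ?_
  · rintro V f _ ⟨a, ha, rfl⟩
    exact map_mono L f (le_sSup ha)
  · refine (map_sSup (L.map f.op).hom s).trans_le (sSup_le ?_)
    rintro _ ⟨a, ha, rfl⟩
    simpa using hb (𝟙 V) (L.map f.op a) ⟨a, ha, by rw [Category.id_comp]⟩

namespace IFrame

variable (L : IFrame J) {U V : C}

theorem ext_of_cover {R : Sieve U} (hR : R ∈ J U) {a b : L.obj.obj (op U)}
    (h : ∀ ⦃V : C⦄ (f : V ⟶ U), R f → L.obj.map f.op a = L.obj.map f.op b) : a = b :=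
  (L.isSheaf R hR).isSeparatedFor.ext fun _ f hf => h f hf

theorem le_of_cover {R : Sieve U} (hR : R ∈ J U) {a b : L.obj.obj (op U)}
    (h : ∀ ⦃V : C⦄ (f : V ⟶ U), R f → L.obj.map f.op a ≤ L.obj.map f.op b) : a ≤ b :=
  inf_eq_left.1 <| L.ext_of_cover hR fun V f hf => by
    rw [map_inf]
    exact inf_eq_left.2 (h f hf)

/-- The internal join of a family. -/
noncomputable def sup (Φ : SubFamily (L.obj ⋙ forget Frm) U) : L.obj.obj (op U) :=
  (L.exists_isJoin Φ).choose

theorem isJoin_sup (Φ : SubFamily (L.obj ⋙ forget Frm) U) : IsJoin L.obj Φ (L.sup Φ) :=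
  (L.exists_isJoin Φ).choose_spec

theorem map_sup (f : V ⟶ U) (Φ : SubFamily (L.obj ⋙ forget Frm) U) :
    L.obj.map f.op (L.sup Φ) = L.sup (Φ.pull f) :=
  ((L.isJoin_sup Φ).pull f).unique (L.isJoin_sup _)

variable {L}

theorem inf_le_iff_of_isJoin {Φ : SubFamily (L.obj ⋙ forget Frm) U} {s t b : L.obj.obj (op U)}
    (h : IsJoin L.obj Φ s) : s ⊓ t ≤ b ↔
      ∀ ⦃V : C⦄ (f : V ⟶ U) (a : L.obj.obj (op V)), a ∈ Φ.carrier f →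
        a ⊓ L.obj.map f.op t ≤ L.obj.map f.op b := by
  rw [(L.inf_isJoin Φ s t h).le_iff]
  constructor
  · exact fun H V f a ha => H f _ ⟨a, ha, rfl⟩
  · rintro H V f _ ⟨a, ha, rfl⟩
    exact H f a ha

theorem le_of_forall_inf_le (Φ : SubFamily (L.obj ⋙ forget Frm) U)
    (total : ∀ c : L.obj.obj (op U), (∀ ⦃V : C⦄ (f : V ⟶ U) (a : L.obj.obj (op V)),
      a ∈ Φ.carrier f → a ≤ L.obj.map f.op c) → ⊤ ≤ c) {t b : L.obj.obj (op U)}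
    (h : ∀ ⦃V : C⦄ (f : V ⟶ U) (a : L.obj.obj (op V)), a ∈ Φ.carrier f →
      a ⊓ L.obj.map f.op t ≤ L.obj.map f.op b) : t ≤ b := by
  have sup_eq_top : L.sup Φ = ⊤ := top_le_iff.1 <| total _ fun V f a ha => (L.isJoin_sup Φ).le ha
  rw [← top_inf_eq t, ← sup_eq_top, inf_le_iff_of_isJoin (L.isJoin_sup Φ)]
  exact h

theorem inf_inf_le_of_isJoin {Φ Ψ : SubFamily (L.obj ⋙ forget Frm) U}
    {s t b : L.obj.obj (op U)} (hs : IsJoin L.obj Φ s) (ht : IsJoin L.obj Ψ t)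
    (h : ∀ ⦃V : C⦄ (f : V ⟶ U) (a c : L.obj.obj (op V)), a ∈ Φ.carrier f → c ∈ Ψ.carrier f →
      a ⊓ c ≤ L.obj.map f.op b) : s ⊓ t ≤ b := by
  refine (inf_le_iff_of_isJoin hs).2 fun V f a ha => ?_
  rw [inf_comm]
  refine (inf_le_iff_of_isJoin (ht.pull f)).2 fun W g c hc => ?_
  rw [inf_comm, map_map]
  exact h _ _ _ (Φ.restrict f a ha g) hc

section Hom

variable {M : IFrame J}

/-- The action of a frame homomorphism on sections. -/
abbrev ap (φ : M ⟶ L) {U : C} (a : M.obj.obj (op U)) : L.obj.obj (op U) :=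
  IFrame.Hom.hom φ |>.app (op U) a

variable (φ : M ⟶ L)

theorem ap_map (f : V ⟶ U) (a : M.obj.obj (op U)) :
    ap φ (M.obj.map f.op a) = L.obj.map f.op (ap φ a) :=
  NatTrans.naturality_apply (IFrame.Hom.hom φ) f.op a

theorem ap_top (U : C) : ap φ (⊤ : M.obj.obj (op U)) = ⊤ :=
  map_top ((IFrame.Hom.hom φ).app (op U)).hom

theorem ap_inf (a b : M.obj.obj (op U)) : ap φ (a ⊓ b) = ap φ a ⊓ ap φ b :=
  map_inf ((IFrame.Hom.hom φ).app (op U)).hom a b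

theorem ap_mono {a b : M.obj.obj (op U)} (h : a ≤ b) : ap φ a ≤ ap φ b :=
  OrderHomClass.mono ((IFrame.Hom.hom φ).app (op U)).hom h

theorem ap_isJoin_inf_le_iff {Φ : SubFamily (M.obj ⋙ forget Frm) U} {s : M.obj.obj (op U)}
    (h : IsJoin M.obj Φ s) {t b : L.obj.obj (op U)} : ap φ s ⊓ t ≤ b ↔
      ∀ ⦃V : C⦄ (f : V ⟶ U) (a : M.obj.obj (op V)), a ∈ Φ.carrier f →
        ap φ a ⊓ L.obj.map f.op t ≤ L.obj.map f.op b := by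
  rw [inf_le_iff_of_isJoin (IFrame.Hom.isJoin φ Φ s h)]
  constructor
  · exact fun H V f a ha => H f _ ⟨a, ha, rfl⟩
  · rintro H V f _ ⟨a, ha, rfl⟩
    exact H f a ha

theorem ap_isJoin_le_iff {Φ : SubFamily (M.obj ⋙ forget Frm) U} {s : M.obj.obj (op U)}
    (h : IsJoin M.obj Φ s) {b : L.obj.obj (op U)} : ap φ s ≤ b ↔
      ∀ ⦃V : C⦄ (f : V ⟶ U) (a : M.obj.obj (op V)), a ∈ Φ.carrier f →
        ap φ a ≤ L.obj.map f.op b := by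
  simpa using ap_isJoin_inf_le_iff φ h (t := ⊤) (b := b)

theorem hom_ext {φ ψ : M ⟶ L} (h : ∀ ⦃U : C⦄ (a : M.obj.obj (op U)), ap φ a = ap ψ a) :
    φ = ψ := by
  apply IFrame.Hom.ext
  ext U a
  exact h a

/-- A frame homomorphism from its action on sections; only one half of the preservation of joins
is assumed, the other one follows from monotonicity. -/
def Hom.ofFun (E : ∀ ⦃U : C⦄, M.obj.obj (op U) → L.obj.obj (op U))
    (nat : ∀ ⦃U V : C⦄ (f : V ⟶ U) (a : M.obj.obj (op U)),
      E (M.obj.map f.op a) = L.obj.map f.op (E a))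
    (top : ∀ U : C, E (⊤ : M.obj.obj (op U)) = ⊤)
    (inf : ∀ ⦃U : C⦄ (a b : M.obj.obj (op U)), E (a ⊓ b) = E a ⊓ E b)
    (join : ∀ ⦃U : C⦄ (Φ : SubFamily (M.obj ⋙ forget Frm) U) (s : M.obj.obj (op U))
      (b : L.obj.obj (op U)), IsJoin M.obj Φ s →
      (∀ ⦃V : C⦄ (f : V ⟶ U) (a : M.obj.obj (op V)), a ∈ Φ.carrier f → E a ≤ L.obj.map f.op b) →
      E s ≤ b) : M ⟶ L :=
  have mono : ∀ ⦃U : C⦄, Monotone (@E U) := fun U a b h => by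
    rw [← inf_eq_left, ← inf, inf_eq_left.2 h]
  have map_sSup : ∀ ⦃U : C⦄ (s : Set (M.obj.obj (op U))), E (sSup s) = sSup (@E U '' s) := by
    refine fun U s => le_antisymm (join _ _ _ (isJoin_constFamily M.obj s) ?_)
      (sSup_le (Set.forall_mem_image.2 fun a ha => mono (le_sSup ha)))
    rintro V f _ ⟨a, ha, rfl⟩
    rw [nat]
    exact map_mono L.obj f (le_sSup (Set.mem_image_of_mem _ ha))
  IFrame.Hom.mk
    { app := fun U => Frm.ofHom
        { toFun := @E U.unop
          map_inf' := @inf U.unop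
          map_top' := top U.unop
          map_sSup' := @map_sSup U.unop }
      naturality := fun U V f => Frm.hom_ext (DFunLike.ext _ _ fun a => nat f.unop a) }
    (fun Φ s h => by
      refine .of_le ?_ fun V f b H => ?_
      · rintro V f _ ⟨a, ha, rfl⟩
        exact (mono (h.le ha)).trans_eq (nat f s)
      · refine (nat f s).symm.trans_le (join _ _ b (h.pull f) fun W g a ha => ?_)
        exact H g _ ⟨a, ha, rfl⟩)

end Hom

end IFrame

/-- An approximable relation between internal frames: the data of a frame homomorphism whose value
at `m` is the internal join of all `a` with `rel m a`. -/
structure ApproximableRel (M L : IFrame J) where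
  /-- `a` is one of the approximations to the value at `m`. -/
  rel : ∀ ⦃U : C⦄, M.obj.obj (op U) → L.obj.obj (op U) → Prop
  restrict : ∀ ⦃U V : C⦄ (f : V ⟶ U) {m a}, rel m a → rel (M.obj.map f.op m) (L.obj.map f.op a)
  mono : ∀ ⦃U : C⦄ {m m' : M.obj.obj (op U)} {a}, m ≤ m' → rel m a → rel m' a
  top : ∀ ⦃U : C⦄ (b : L.obj.obj (op U)),
    (∀ ⦃V : C⦄ (f : V ⟶ U) (a), rel ⊤ a → a ≤ L.obj.map f.op b) → ⊤ ≤ b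
  inf : ∀ ⦃U : C⦄ {m m' : M.obj.obj (op U)} {a a' b}, rel m a → rel m' a' →
    (∀ ⦃V : C⦄ (f : V ⟶ U) (c), rel (M.obj.map f.op (m ⊓ m')) c → c ≤ L.obj.map f.op b) →
      a ⊓ a' ≤ b
  join : ∀ ⦃U : C⦄ {Φ : SubFamily (M.obj ⋙ forget Frm) U} {s a b}, IsJoin M.obj Φ s → rel s a →
    (∀ ⦃V : C⦄ (f : V ⟶ U) (m c), m ∈ Φ.carrier f → rel m c → c ≤ L.obj.map f.op b) → a ≤ b

namespace ApproximableRel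

variable {M L : IFrame J} (G : ApproximableRel M L) {U V : C}

/-- The approximations to the value at `m`. -/
def approximations (m : M.obj.obj (op U)) : SubFamily (L.obj ⋙ forget Frm) U where
  carrier _ f := {a | G.rel (M.obj.map f.op m) a}
  restrict V f a h W g := by
    simpa using G.restrict g h

/-- The value at `m` of the homomorphism. -/
noncomputable def val (m : M.obj.obj (op U)) : L.obj.obj (op U) := L.sup (G.approximations m)

theorem val_map (f : V ⟶ U) (m : M.obj.obj (op U)) :
    G.val (M.obj.map f.op m) = L.obj.map f.op (G.val m) := by
  rw [val, val, L.map_sup]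
  congr 1
  exact SubFamily.ext_mem fun W g a => by
    simp [approximations, SubFamily.pull]

theorem val_le_iff {m : M.obj.obj (op U)} {b : L.obj.obj (op U)} : G.val m ≤ b ↔
    ∀ ⦃V : C⦄ (f : V ⟶ U) (a), G.rel (M.obj.map f.op m) a → a ≤ L.obj.map f.op b :=
  (L.isJoin_sup (G.approximations m)).le_iff

theorem le_val {m : M.obj.obj (op U)} {a : L.obj.obj (op U)} (h : G.rel m a) : a ≤ G.val m := by
  simpa using G.val_le_iff.1 le_rfl (𝟙 U) a (by simpa using h)

theorem val_top : G.val (⊤ : M.obj.obj (op U)) = ⊤ :=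
  top_le_iff.1 <| G.top _ fun V f a h => by
    rw [← G.val_map, map_top]
    exact G.le_val h

theorem val_mono {m m' : M.obj.obj (op U)} (h : m ≤ m') : G.val m ≤ G.val m' :=
  G.val_le_iff.2 fun V f a ha => by
    rw [← G.val_map]
    exact G.le_val (G.mono (map_mono _ f h) ha)

theorem val_inf (m m' : M.obj.obj (op U)) : G.val (m ⊓ m') = G.val m ⊓ G.val m' := by
  refine le_antisymm (le_inf (G.val_mono inf_le_left) (G.val_mono inf_le_right)) ?_
  refine IFrame.inf_inf_le_of_isJoin (L.isJoin_sup _) (L.isJoin_sup _) fun V f a a' ha ha' => ?_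
  refine G.inf ha ha' fun W g c hc => ?_
  rw [map_map, ← G.val_map]
  refine G.le_val ?_
  simpa using hc

/-- The homomorphism with values `⋁ {a | rel m a}`. -/
noncomputable def hom : M ⟶ L :=
  IFrame.Hom.ofFun (fun _ m => G.val m) (fun _ _ => G.val_map) (fun _ => G.val_top)
    (fun _ => G.val_inf) (fun _ Φ s b h H => G.val_le_iff.2 fun V f a ha =>
      G.join (h.pull f) ha fun W g m c hm hc => by
        rw [map_map]
        exact (G.le_val hc).trans (H _ m hm))

theorem ap_hom_le_iff {m : M.obj.obj (op U)} {b : L.obj.obj (op U)} : IFrame.ap G.hom m ≤ b ↔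
    ∀ ⦃V : C⦄ (f : V ⟶ U) (a), G.rel (M.obj.map f.op m) a → a ≤ L.obj.map f.op b :=
  G.val_le_iff

theorem le_ap_hom {m : M.obj.obj (op U)} {a : L.obj.obj (op U)} (h : G.rel m a) :
    a ≤ IFrame.ap G.hom m :=
  G.le_val h

end ApproximableRel

namespace IFrame

variable (L : IFrame J) {X : Cᵒᵖ ⥤ Type u} {U V : C}

/-- All elements of `L`, but only at the stages where `x = x'`. -/
def eqFamily (x x' : X.obj (op U)) : SubFamily (L.obj ⋙ forget Frm) U where
  carrier _ f := {_a | X.map f.op x = X.map f.op x'}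
  restrict _ f _ h _ g := by
    have h : X.map f.op x = X.map f.op x' := h
    change X.map (g ≫ f).op x = X.map (g ≫ f).op x'
    rw [← map_map, h, map_map]

/-- The truth value in `L` of the equality `x = x'`. -/
noncomputable def eqv (x x' : X.obj (op U)) : L.obj.obj (op U) := L.sup (L.eqFamily x x')

theorem map_eqv (f : V ⟶ U) (x x' : X.obj (op U)) :
    L.obj.map f.op (L.eqv x x') = L.eqv (X.map f.op x) (X.map f.op x') := by
  rw [eqv, eqv, L.map_sup]
  congr 1
  exact SubFamily.ext_mem fun W g a => by
    simp [eqFamily, SubFamily.pull]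

theorem eqv_self (x : X.obj (op U)) : L.eqv x x = ⊤ :=
  top_le_iff.1 <| by simpa [eqv] using (L.isJoin_sup (L.eqFamily x x)).le (f := 𝟙 U) (a := ⊤) rfl

variable {L}

theorem eqv_inf_le_iff {x x' : X.obj (op U)} {t b : L.obj.obj (op U)} : L.eqv x x' ⊓ t ≤ b ↔
    ∀ ⦃V : C⦄ (f : V ⟶ U), X.map f.op x = X.map f.op x' → L.obj.map f.op t ≤ L.obj.map f.op b :=
  (inf_le_iff_of_isJoin (L.isJoin_sup _)).trans
    ⟨fun H _ f h => by simpa using H f ⊤ h, fun H _ f _ h => inf_le_right.trans (H f h)⟩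

theorem eqv_le_iff {x x' : X.obj (op U)} {b : L.obj.obj (op U)} : L.eqv x x' ≤ b ↔
    ∀ ⦃V : C⦄ (f : V ⟶ U), X.map f.op x = X.map f.op x' → ⊤ ≤ L.obj.map f.op b := by
  simpa using eqv_inf_le_iff (t := ⊤) (b := b) (x := x) (x' := x')

theorem ap_eqv {M : IFrame J} (φ : M ⟶ L) (x x' : X.obj (op U)) :
    ap φ (M.eqv x x') = L.eqv x x' := by
  apply le_antisymm
  · refine (ap_isJoin_le_iff φ (M.isJoin_sup _)).2 fun V f a h => ?_
    have h : X.map f.op x = X.map f.op x' := h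
    rw [map_eqv, h, eqv_self]
    exact le_top
  · refine eqv_le_iff.2 fun V f h => ?_
    rw [← ap_map, map_eqv, h, eqv_self, ap_top]

end IFrame

/-- A partition of an internal locale indexed by `X`: the opens `f⁻¹{x}` for a map `f` to the
discrete space `X`. -/
structure IPartition (X : Cᵒᵖ ⥤ Type u) (L : IFrame J) where
  /-- The members of the partition. -/
  app : ∀ ⦃U : C⦄, X.obj (op U) → L.obj.obj (op U)
  nat : ∀ ⦃U V : C⦄ (f : V ⟶ U) (x : X.obj (op U)), app (X.map f.op x) = L.obj.map f.op (app x)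
  total : ∀ ⦃U : C⦄ (b : L.obj.obj (op U)),
    (∀ ⦃V : C⦄ (f : V ⟶ U) (x : X.obj (op V)), app x ≤ L.obj.map f.op b) → ⊤ ≤ b
  disjoint : ∀ ⦃U : C⦄ (x x' : X.obj (op U)), app x ⊓ app x' ≤ L.eqv x x'

namespace IPartition

variable {X : Cᵒᵖ ⥤ Type u} {L : IFrame J} (p : IPartition X L) {U : C}

theorem le_of_forall {t b : L.obj.obj (op U)}
    (h : ∀ ⦃V : C⦄ (f : V ⟶ U) (x : X.obj (op V)), p.app x ⊓ L.obj.map f.op t ≤ L.obj.map f.op b) :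
    t ≤ b := by
  let members : SubFamily (L.obj ⋙ forget Frm) U :=
    { carrier := fun V _ => Set.range (@p.app V)
      restrict := by
        rintro V _ _ ⟨x, rfl⟩ W g
        exact ⟨_, p.nat g x⟩ }
  refine IFrame.le_of_forall_inf_le members (fun c hc => p.total c fun V f x => hc f _ ⟨x, rfl⟩) ?_
  rintro V f _ ⟨x, rfl⟩
  exact h f x

theorem inf_inf_le {x x' : X.obj (op U)} {t b : L.obj.obj (op U)}
    (h : ∀ ⦃V : C⦄ (f : V ⟶ U), X.map f.op x = X.map f.op x' →
      p.app (X.map f.op x) ⊓ L.obj.map f.op t ≤ L.obj.map f.op b) :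
    p.app x ⊓ p.app x' ⊓ t ≤ b := by
  have : L.eqv x x' ⊓ (p.app x ⊓ t) ≤ b := IFrame.eqv_inf_le_iff.2 fun V f e => by
    rw [map_inf, ← p.nat]
    exact h f e
  exact (le_inf (inf_le_left.trans (p.disjoint x x'))
    (inf_le_inf_right t inf_le_left)).trans this

theorem eqv_inf_le (x x' : X.obj (op U)) : L.eqv x x' ⊓ p.app x ≤ p.app x' :=
  IFrame.eqv_inf_le_iff.2 fun V f e => by
    rw [← p.nat, ← p.nat, e]

end IPartition

section Power

variable {X : Sheaf J (Type u)} {L : IFrame J} {U V : C}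

/-- The open point `{x}`, as a section of the frame `power X`. -/
def pt (x : X.obj.obj (op U)) : LocalFamily J X.obj U := point X x

theorem mem_pt {x : X.obj.obj (op U)} {f : V ⟶ U} {z : X.obj.obj (op V)} :
    z ∈ (pt x).carrier f ↔ z = X.obj.map f.op x :=
  Iff.rfl

theorem mem_pt_id {x z : X.obj.obj (op U)} : z ∈ (pt x).carrier (𝟙 U) ↔ z = x := by
  simp [mem_pt]

theorem map_point (f : V ⟶ U) (x : X.obj.obj (op U)) :
    (power X).obj.map f.op (point X x) = point X (X.obj.map f.op x) :=
  LocalFamily.ext_mem (S := (pt x).pull f) (T := pt (X.obj.map f.op x)) fun W g z => by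
    rw [LocalFamily.mem_pull, mem_pt, mem_pt, map_map]

theorem mem_pull_id {P : Cᵒᵖ ⥤ Type u} (S : LocalFamily J P U) (f : V ⟶ U) {x : P.obj (op V)} :
    x ∈ (S.pull f).carrier (𝟙 V) ↔ x ∈ S.carrier f := by
  rw [LocalFamily.mem_pull, Category.id_comp]

theorem pt_le_iff {x : X.obj.obj (op U)} {T : LocalFamily J X.obj U} :
    pt x ≤ T ↔ x ∈ T.carrier (𝟙 U) := by
  refine ⟨fun h => h (𝟙 U) x (mem_pt_id.2 rfl), ?_⟩
  rintro h V f z rfl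
  simpa using T.restrict (𝟙 U) x h f

/-- The points of a subsheaf. -/
def pointsFamily (T : LocalFamily J X.obj U) : SubFamily ((power X).obj ⋙ forget Frm) U where
  carrier _ f := point X '' T.carrier f
  restrict := by
    rintro V f _ ⟨x, hx, rfl⟩ W g
    exact ⟨_, T.restrict f x hx g, (map_point g x).symm⟩

theorem isJoin_pointsFamily (T : LocalFamily J X.obj U) :
    IsJoin (power X).obj (pointsFamily T) T := by
  refine .of_le ?_ fun V f (b : LocalFamily J X.obj V) H W g x hx => ?_
  · rintro V f _ ⟨x, hx, rfl⟩
    exact pt_le_iff.2 ((mem_pull_id T f).2 hx)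
  · exact (mem_pull_id b g).1 (pt_le_iff.1 (H g _ ⟨x, hx, rfl⟩))

theorem ap_power_le_iff (φ : power X ⟶ L) {T : LocalFamily J X.obj U} {b : L.obj.obj (op U)} :
    IFrame.ap φ (U := U) T ≤ b ↔ ∀ ⦃V : C⦄ (f : V ⟶ U) (x : X.obj.obj (op V)),
      x ∈ T.carrier f → IFrame.ap φ (point X x) ≤ L.obj.map f.op b :=
  (IFrame.ap_isJoin_le_iff φ (isJoin_pointsFamily T)).trans
    ⟨fun H _ f x hx => H f _ ⟨x, hx, rfl⟩, fun H _ f _ ⟨x, hx, e⟩ => e ▸ H f x hx⟩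

theorem power_hom_ext {φ ψ : power X ⟶ L}
    (h : ∀ ⦃U : C⦄ (x : X.obj.obj (op U)),
      IFrame.ap φ (point X x) = IFrame.ap ψ (point X x)) : φ = ψ := by
  refine IFrame.hom_ext fun U T => eq_of_forall_ge_iff fun b => ?_
  refine (ap_power_le_iff φ).trans (Iff.trans ?_ (ap_power_le_iff ψ).symm)
  simp only [h]

namespace IPartition

/-- The partition of a locale given by a map to a discrete space. -/
def ofHom (φ : power X ⟶ L) : IPartition X.obj L where
  app _ x := IFrame.ap φ (point X x)
  nat _ _ f x := (congrArg (IFrame.ap φ) (map_point f x)).symm.trans (IFrame.ap_map φ f _)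
  total U b h := by
    rw [← IFrame.ap_top φ U]
    exact (ap_power_le_iff φ (T := ⊤)).2 fun V f x _ => h f x
  disjoint U x x' := by
    refine (IFrame.ap_inf φ _ _).symm.trans_le ((ap_power_le_iff φ (T := pt x ⊓ pt x')).2 ?_)
    rintro V f _ ⟨rfl, e : X.obj.map f.op x = X.obj.map f.op x'⟩
    rw [L.map_eqv, e, L.eqv_self]
    exact le_top

/-- The map to a discrete space given by a partition: an approximation to the preimage of `S` is a
member of the partition at an element of `S`. -/
def approximableRel (p : IPartition X.obj L) : ApproximableRel (power X) L where
  rel U (S : LocalFamily J X.obj U) a := ∃ x ∈ S.carrier (𝟙 U), a = p.app x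
  restrict := by
    rintro U V f (S : LocalFamily J X.obj U) _ ⟨x, hx, rfl⟩
    exact ⟨X.obj.map f.op x, (mem_pull_id S f).2 (by simpa using S.restrict (𝟙 U) x hx f),
      (p.nat f x).symm⟩
  mono := by
    rintro U S S' _ h ⟨x, hx, rfl⟩
    exact ⟨x, h _ x hx, rfl⟩
  top U b h := p.total b fun V f x => h f _ ⟨x, trivial, rfl⟩
  inf := by
    rintro U (S : LocalFamily J X.obj U) (S' : LocalFamily J X.obj U) _ _ b ⟨x, hx, rfl⟩
      ⟨x', hx', rfl⟩ h
    rw [← inf_top_eq (_ ⊓ _)]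
    refine p.inf_inf_le fun V f e => inf_le_left.trans (h f _ ⟨X.obj.map f.op x, ?_, rfl⟩)
    refine (mem_pull_id (S ⊓ S') f).2 ⟨by simpa using S.restrict (𝟙 U) x hx f, ?_⟩
    rw [e]
    simpa using S'.restrict (𝟙 U) x' hx' f
  join := by
    rintro U Φ s _ b hs ⟨x, hx, rfl⟩ h
    rw [hs.unique (isJoin_unionFamily X.obj Φ)] at hx
    obtain ⟨R, hR, hx⟩ := hx
    refine L.le_of_cover hR fun V f hf => ?_
    obtain ⟨T, hT, hx⟩ := hx f hf
    rw [Category.comp_id] at hT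
    exact h f T _ hT ⟨_, hx, (p.nat f x).symm⟩

/-- The map to a discrete space given by a partition. -/
noncomputable def hom (p : IPartition X.obj L) : power X ⟶ L := p.approximableRel.hom

theorem ap_hom_point (p : IPartition X.obj L) (x : X.obj.obj (op U)) :
    IFrame.ap p.hom (point X x) = p.app x := by
  apply le_antisymm
  · refine p.approximableRel.ap_hom_le_iff.2 fun V f a h => ?_
    rw [map_point] at h
    obtain ⟨z, hz, rfl⟩ := h
    rw [mem_pt_id.1 hz, p.nat]
  · exact p.approximableRel.le_ap_hom ⟨x, mem_pt_id.2 rfl, rfl⟩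

end IPartition

end Power

/-- A section over `U` of the internal power `L ^ X`.  As frames of opens, `L ^ X` is the product
of the locale with frame of opens `L` and the discrete space `X`. -/
@[ext]
structure PowSection (L : IFrame J) (X : Cᵒᵖ ⥤ Type u) (U : C) where
  /-- The values. -/
  app : ∀ ⦃V : C⦄ (_ : V ⟶ U), X.obj (op V) → L.obj.obj (op V)
  nat : ∀ ⦃V W : C⦄ (f : V ⟶ U) (g : W ⟶ V) (x : X.obj (op V)),
    app (g ≫ f) (X.map g.op x) = L.obj.map g.op (app f x)

namespace PowSection

variable {L : IFrame J} {X : Cᵒᵖ ⥤ Type u} {U V : C}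

theorem ext_app {s t : PowSection L X U}
    (h : ∀ ⦃V : C⦄ (f : V ⟶ U) (x : X.obj (op V)), s.app f x = t.app f x) : s = t := by
  ext V f x
  exact h f x

theorem app_eq_map (s : PowSection L X U) (f : V ⟶ U) (x : X.obj (op U)) :
    s.app f (X.map f.op x) = L.obj.map f.op (s.app (𝟙 U) x) := by
  simpa using s.nat (𝟙 U) f x

instance : PartialOrder (PowSection L X U) where
  le s t := ∀ ⦃V : C⦄ (f : V ⟶ U) (x : X.obj (op V)), s.app f x ≤ t.app f x
  le_refl _ _ _ _ := le_rfl
  le_trans _ _ _ h h' _ f x := (h f x).trans (h' f x)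
  le_antisymm _ _ h h' := ext_app fun _ f x => le_antisymm (h f x) (h' f x)

instance : SupSet (PowSection L X U) where
  sSup S :=
    { app := fun V f x => sSup ((fun s => s.app f x) '' S)
      nat := fun V W f g x => by
        refine Eq.trans ?_ (map_sSup (L.obj.map g.op).hom _).symm
        rw [Set.image_image]
        simp only [nat] }

/-- Everything but the infima of sets is computed pointwise. -/
instance : CompleteLattice (PowSection L X U) where
  __ := completeLatticeOfSup (PowSection L X U) fun S =>
    ⟨fun s hs _ f x => le_sSup (Set.mem_image_of_mem (fun s : PowSection L X U => s.app f x) hs),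
      fun _ ht _ f x => sSup_le (Set.forall_mem_image.2 fun _ hs => ht hs f x)⟩
  inf s t := ⟨fun _ f x => s.app f x ⊓ t.app f x, fun V W f g x => by
    rw [s.nat, t.nat, map_inf]⟩
  inf_le_left _ _ _ _ _ := inf_le_left
  inf_le_right _ _ _ _ _ := inf_le_right
  le_inf _ _ _ h h' _ f x := le_inf (h f x) (h' f x)
  top := ⟨fun _ _ _ => ⊤, fun _ _ _ g _ => (map_top (L.obj.map g.op).hom).symm⟩
  le_top _ _ _ _ := le_top

theorem inf_app (s t : PowSection L X U) (f : V ⟶ U) (x : X.obj (op V)) :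
    (s ⊓ t).app f x = s.app f x ⊓ t.app f x := rfl

theorem sSup_app (S : Set (PowSection L X U)) (f : V ⟶ U) (x : X.obj (op V)) :
    (sSup S).app f x = sSup ((fun s => s.app f x) '' S) := rfl

instance : Order.Frame (PowSection L X U) := Order.Frame.ofMinimalAxioms
  { inf_sSup_le_iSup_inf := by
      intro t S V f x
      rw [inf_app, sSup_app, inf_sSup_eq]
      refine iSup₂_le (Set.forall_mem_image.2 fun s hs => ?_)
      have h : t ⊓ s ≤ ⨆ b ∈ S, t ⊓ b := le_iSup₂_of_le s hs le_rfl
      exact h f x }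

/-- Evaluation at an element of `X`, as a frame homomorphism. -/
def appHom (f : V ⟶ U) (x : X.obj (op V)) : FrameHom (PowSection L X U) (L.obj.obj (op V)) where
  toFun s := s.app f x
  map_inf' _ _ := rfl
  map_top' := rfl
  map_sSup' _ := rfl

/-- Restriction of sections. -/
def pull {U' : C} (h : U' ⟶ U) (s : PowSection L X U) : PowSection L X U' where
  app _ f := s.app (f ≫ h)
  nat _ _ f g x := by
    rw [Category.assoc, s.nat]

theorem pull_app {U' : C} (h : U' ⟶ U) (s : PowSection L X U) (f : V ⟶ U') (x : X.obj (op V)) :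
    (s.pull h).app f x = s.app (f ≫ h) x := rfl

theorem pull_app_id (h : V ⟶ U) (s : PowSection L X U) (x : X.obj (op V)) :
    (s.pull h).app (𝟙 V) x = s.app h x := by
  rw [pull_app, Category.id_comp]

/-- Restriction is a frame homomorphism. -/
def pullHom {U' : C} (h : U' ⟶ U) : FrameHom (PowSection L X U) (PowSection L X U') where
  toFun := pull h
  map_inf' _ _ := rfl
  map_top' := rfl
  map_sSup' S := ext_app fun V f x => by
    rw [pull_app, sSup_app, sSup_app, Set.image_image]
    rfl

end PowSection

section PowFrame

variable (L : IFrame J) (X : Cᵒᵖ ⥤ Type u) {U V : C}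

/-- The presheaf of sections of `L ^ X`. -/
def powFrm : Cᵒᵖ ⥤ Frm.{u} where
  obj U := Frm.of (PowSection L X U.unop)
  map h := Frm.ofHom (PowSection.pullHom h.unop)
  map_id _ := Frm.hom_ext <| DFunLike.ext _ _ fun (s : PowSection L X _) =>
    PowSection.ext_app fun _ f x => congrArg (s.app · x) (Category.comp_id f)
  map_comp h k := Frm.hom_ext <| DFunLike.ext _ _ fun (s : PowSection L X _) =>
    PowSection.ext_app fun _ f x => congrArg (s.app · x) (Category.assoc f k.unop h.unop).symm

/-- The sections of `L ^ X` are those of the internal hom of presheaves. -/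
def powFrmIso : powFrm L X ⋙ forget Frm ≅ presheafHom X (L.obj ⋙ forget Frm) :=
  NatIso.ofComponents (fun U => Equiv.toIso
    { toFun := fun (s : PowSection L X U.unop) =>
        { app := fun V => ↾fun x => s.app V.unop.hom x
          naturality := fun V W g => by
            ext x
            have := s.nat V.unop.hom g.unop.left x
            rw [Over.w] at this
            exact this }
      invFun := fun t => show PowSection L X U.unop from
        { app := fun V f x => t.app (op (Over.mk f)) x
          nat := fun V W f g x =>
            NatTrans.naturality_apply t (Over.homMk g : Over.mk (g ≫ f) ⟶ Over.mk f).op x }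
      left_inv := fun _ => rfl
      right_inv := fun _ => rfl }) fun _ => rfl

theorem powFrm_isSheaf : Presieve.IsSheaf J (powFrm L X ⋙ forget Frm) :=
  Presieve.isSheaf_iso J (powFrmIso L X).symm <| (isSheaf_iff_isSheaf_of_type J _).1 <|
    Presheaf.IsSheaf.hom _ _ ((isSheaf_iff_isSheaf_of_type J _).2 L.isSheaf)

variable {L X}

/-- The values at `x` of a family of sections of `L ^ X`. -/
def evalFamily (Φ : SubFamily (powFrm L X ⋙ forget Frm) U) (f : V ⟶ U) (x : X.obj (op V)) :
    SubFamily (L.obj ⋙ forget Frm) V where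
  carrier W g := {c | ∃ m : PowSection L X W, m ∈ Φ.carrier (g ≫ f) ∧
    c = m.app (𝟙 W) (X.map g.op x)}
  restrict := by
    rintro W g _ ⟨m, hm, rfl⟩ W' k
    refine ⟨m.pull k, ?_, ?_⟩
    · rw [Category.assoc]
      exact Φ.restrict _ _ hm k
    · rw [PowSection.pull_app_id, ← map_map, PowSection.app_eq_map]
      rfl

/-- The pointwise join of a family of sections of `L ^ X`. -/
noncomputable def powSup (Φ : SubFamily (powFrm L X ⋙ forget Frm) U) : PowSection L X U where
  app _ f x := L.sup (evalFamily Φ f x)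
  nat V W f g x := by
    rw [L.map_sup]
    congr 1
    exact SubFamily.ext_mem fun W' k a => by
      simp [evalFamily, SubFamily.pull]

theorem isJoin_powSup (Φ : SubFamily (powFrm L X ⋙ forget Frm) U) :
    IsJoin (powFrm L X) Φ (powSup Φ) := by
  refine .of_le (fun V f (a : PowSection L X V) ha W g x => ?_)
    fun V f (b : PowSection L X V) H W g x => ?_
  · have hm : a.pull g ∈ Φ.carrier (𝟙 W ≫ g ≫ f) := by
      rw [Category.id_comp]
      exact Φ.restrict _ _ ha g
    have := (L.isJoin_sup (evalFamily Φ (g ≫ f) x)).le ⟨a.pull g, hm, rfl⟩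
    rw [op_id, Functor.map_id_apply, PowSection.pull_app_id, Functor.map_id_apply] at this
    exact this
  · refine (L.isJoin_sup (evalFamily Φ (g ≫ f) x)).le_iff.2 ?_
    rintro W' k _ ⟨m, hm, rfl⟩
    rw [← Category.assoc] at hm
    rw [← b.nat, ← b.pull_app_id]
    exact H (k ≫ g) m hm (𝟙 W') (X.map k.op x)

theorem IsJoin.app {Φ : SubFamily (powFrm L X ⋙ forget Frm) U} {s : PowSection L X U}
    (h : IsJoin (powFrm L X) Φ s) (f : V ⟶ U) (x : X.obj (op V)) :
    IsJoin L.obj (evalFamily Φ f x) (s.app f x) := by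
  have e : s = powSup Φ := h.unique (isJoin_powSup Φ)
  rw [e]
  exact L.isJoin_sup _

variable (L X) in
/-- The frame `L ^ X`. -/
def powFrame : IFrame J where
  obj := powFrm L X
  isSheaf := powFrm_isSheaf L X
  exists_isJoin Φ := ⟨_, isJoin_powSup Φ⟩
  inf_isJoin {U} Φ (s : PowSection L X U) (t : PowSection L X U) h := by
    refine .of_le ?_ fun V f (b : PowSection L X V) H W g x => ?_
    · rintro V f _ ⟨a, ha, rfl⟩
      exact (inf_le_inf_right _ (h.le ha)).trans_eq rfl
    · refine (IFrame.inf_le_iff_of_isJoin (h.app (g ≫ f) x)).2 ?_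
      rintro W' k _ ⟨m, hm, rfl⟩
      have hm' : m ∈ Φ.carrier ((k ≫ g) ≫ f) := by
        rwa [Category.assoc]
      have := H (k ≫ g) (m ⊓ t.pull ((k ≫ g) ≫ f)) ⟨m, hm', rfl⟩ (𝟙 W') (X.map k.op x)
      change m.app _ _ ⊓ (t.pull ((k ≫ g) ≫ f)).app _ _ ≤ (b.pull (k ≫ g)).app _ _ at this
      rwa [PowSection.pull_app_id, PowSection.pull_app_id, Category.assoc, t.nat, b.nat] at this

end PowFrame

section DiscreteProduct

variable {L T : IFrame J} {X : Cᵒᵖ ⥤ Type u} {U V : C}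

section Projections

variable (X) in
/-- A section of `L` as a constant section of `L ^ X`. -/
def constSection (a : L.obj.obj (op U)) : PowSection L X U where
  app _ f _ := L.obj.map f.op a
  nat _ _ f g _ := (map_map L.obj f g a).symm

theorem constSection_app (a : L.obj.obj (op U)) (f : V ⟶ U) (x : X.obj (op V)) :
    (constSection X a).app f x = L.obj.map f.op a := rfl

variable (L X) in
/-- The frame homomorphism of the projection from `Z × X` to `Z`. -/
def constHom : L ⟶ powFrame L X :=
  IFrame.Hom.ofFun (L := powFrame L X) (fun U a => (constSection X a : PowSection L X U))
    (fun _ _ f a => PowSection.ext_app (L := L) fun _ g _ => map_map L.obj f g a)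
    (fun _ => PowSection.ext_app (L := L) fun _ g _ => map_top (L.obj.map g.op).hom)
    (fun _ a b => PowSection.ext_app (L := L) fun _ g _ => map_inf (L.obj.map g.op).hom a b)
    (fun U Φ s (b : PowSection L X U) h H V f x => (h.pull f).le_iff.2 fun W g a ha => by
      have : constSection X a ≤ b.pull (g ≫ f) := H (g ≫ f) a ha
      simpa [constSection_app, PowSection.pull_app, b.nat] using this (𝟙 W) (X.map g.op x))

theorem powFrame_eqv_app {Y : Cᵒᵖ ⥤ Type u} (y y' : Y.obj (op U)) (f : V ⟶ U)
    (x : X.obj (op V)) : PowSection.app ((powFrame L X).eqv y y') f x =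
      L.eqv (Y.map f.op y) (Y.map f.op y') := by
  rw [← IFrame.ap_eqv (constHom L X), ← L.map_eqv]
  rfl

/-- The section `x' ↦ (x' = x)` of `L ^ X`. -/
noncomputable def diagSection (L : IFrame J) (x : X.obj (op U)) : PowSection L X U where
  app _ f x' := L.eqv x' (X.map f.op x)
  nat _ _ f g x' := by
    rw [L.map_eqv, map_map]

theorem diagSection_app (x : X.obj (op U)) (f : V ⟶ U) (x' : X.obj (op V)) :
    (diagSection L x).app f x' = L.eqv x' (X.map f.op x) := rfl

theorem diagSection_app_self (x : X.obj (op U)) : (diagSection L x).app (𝟙 U) x = ⊤ := by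
  rw [diagSection_app, op_id, Functor.map_id_apply, L.eqv_self]

theorem pull_diagSection (x : X.obj (op U)) (f : V ⟶ U) :
    (diagSection L x).pull f = diagSection L (X.map f.op x) :=
  PowSection.ext_app fun W g x' => by
    rw [PowSection.pull_app, diagSection_app, diagSection_app, map_map]

theorem diagSection_inf_le_iff {x : X.obj (op U)} {s t : PowSection L X U} :
    diagSection L x ⊓ s ≤ t ↔ s.app (𝟙 U) x ≤ t.app (𝟙 U) x := by
  constructor
  · intro h
    simpa only [PowSection.inf_app, diagSection_app_self, top_inf_eq] using h (𝟙 U) x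
  · intro h V f x'
    rw [PowSection.inf_app, diagSection_app]
    refine IFrame.eqv_inf_le_iff.2 fun W g e => ?_
    rw [map_map] at e
    rw [← s.nat, ← t.nat, e, s.app_eq_map, t.app_eq_map]
    exact map_mono _ _ h

theorem diagSection_inf_constSection (x : X.obj (op U)) (s : PowSection L X U) :
    diagSection L x ⊓ s = diagSection L x ⊓ constSection X (s.app (𝟙 U) x) := by
  have e : (constSection X (s.app (𝟙 U) x)).app (𝟙 U) x = s.app (𝟙 U) x := by
    rw [constSection_app, op_id, Functor.map_id_apply]
  exact le_antisymm (le_inf inf_le_left (diagSection_inf_le_iff.2 e.ge))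
    (le_inf inf_le_left (diagSection_inf_le_iff.2 e.le))

variable (L X) in
/-- The partition of `L ^ X` given by the projection of `Z × X` to `X`. -/
noncomputable def diagonal : IPartition X (powFrame L X) where
  app U x := (diagSection L x : PowSection L X U)
  nat _ _ f x := (pull_diagSection x f).symm
  total U (b : PowSection L X U) h V f x := by
    have : diagSection L x ≤ b.pull f := h f x
    have := this (𝟙 V) x
    rwa [diagSection_app_self, b.pull_app_id] at this
  disjoint U x x' := diagSection_inf_le_iff.2 <| by
    rw [powFrame_eqv_app, diagSection_app, op_id, Functor.map_id_apply, Functor.map_id_apply]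

/-- The frame homomorphism of the projection from `Z × X` to `X`. -/
noncomputable def diagHom (L : IFrame J) (X : Sheaf J (Type u)) : power X ⟶ powFrame L X.obj :=
  (diagonal L X.obj).hom

theorem ap_diagHom_point {X : Sheaf J (Type u)} (x : X.obj.obj (op U)) :
    IFrame.ap (diagHom L X) (point X x) = diagSection L x :=
  IPartition.ap_hom_point _ x

end Projections

section Lift

/-- The action of a frame homomorphism on sections of `L ^ X`. -/
def powAp (ψ : powFrame L X ⟶ T) (s : PowSection L X U) : T.obj.obj (op U) :=
  IFrame.ap ψ s

theorem map_powAp (ψ : powFrame L X ⟶ T) (f : V ⟶ U)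
    (s : PowSection L X U) : T.obj.map f.op (powAp ψ s) = powAp ψ (s.pull f) :=
  (IFrame.ap_map ψ f s).symm

theorem powAp_inf (ψ : powFrame L X ⟶ T) (s t : PowSection L X U) :
    powAp ψ (s ⊓ t) = powAp ψ s ⊓ powAp ψ t :=
  IFrame.ap_inf ψ s t

/-- The map to `Z × X` given by a map to `Z` and a partition indexed by `X`: the preimage of an
open `s` is the join of all `p x ⊓ a* (s x)`. -/
def liftRel (a : L ⟶ T) (p : IPartition X T) : ApproximableRel (powFrame L X) T where
  rel U (s : PowSection L X U) c := ∃ x, c ≤ p.app x ⊓ IFrame.ap a (s.app (𝟙 U) x)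
  restrict := by
    rintro U V f (s : PowSection L X U) c ⟨x, hc⟩
    refine ⟨X.map f.op x, (map_mono T.obj f hc).trans_eq ?_⟩
    change _ = p.app _ ⊓ IFrame.ap a ((s.pull f).app _ _)
    rw [s.pull_app_id, s.app_eq_map, map_inf, p.nat, IFrame.ap_map]
  mono := by
    rintro U s s' c h ⟨x, hc⟩
    exact ⟨x, hc.trans (inf_le_inf_left _ (IFrame.ap_mono a (h (𝟙 U) x)))⟩
  top U b h := p.total b fun V f x => h f _ ⟨x, by
    change _ ≤ p.app x ⊓ IFrame.ap a ⊤
    rw [IFrame.ap_top, inf_top_eq]⟩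
  inf := by
    rintro U (s : PowSection L X U) (s' : PowSection L X U) c c' b ⟨x, hc⟩ ⟨x', hc'⟩ h
    refine (inf_le_inf hc hc').trans ?_
    rw [inf_inf_inf_comm]
    refine p.inf_inf_le fun V f e => h f _ ⟨X.map f.op x, inf_le_inf_left _ ?_⟩
    change _ ≤ IFrame.ap a (((s ⊓ s').pull f).app (𝟙 V) (X.map f.op x))
    rw [PowSection.pull_app_id, PowSection.inf_app, IFrame.ap_inf, s.app_eq_map, e, s'.app_eq_map,
      map_inf, IFrame.ap_map, IFrame.ap_map]
  join := by
    rintro U Φ (s : PowSection L X U) c b hs ⟨x, hc⟩ h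
    refine hc.trans ?_
    rw [inf_comm, IFrame.ap_isJoin_inf_le_iff a (IsJoin.app (s := s) hs (𝟙 U) x)]
    rintro V f _ ⟨m, hm, rfl⟩
    rw [Category.comp_id] at hm
    rw [inf_comm, ← p.nat]
    exact h f m _ hm ⟨_, le_rfl⟩

end Lift

section LiftHom

variable (a : L ⟶ T) (p : IPartition X T)

/-- The frame homomorphism of the map to `Z × X` given by a map to `Z` and a partition. -/
noncomputable def liftHom : powFrame L X ⟶ T := (liftRel a p).hom

theorem powAp_liftHom_le_iff {s : PowSection L X U} {c : T.obj.obj (op U)} :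
    powAp (liftHom a p) s ≤ c ↔ ∀ ⦃V : C⦄ (f : V ⟶ U) (x : X.obj (op V)),
      p.app x ⊓ IFrame.ap a (s.app f x) ≤ T.obj.map f.op c := by
  have rel_iff : ∀ ⦃V : C⦄ (f : V ⟶ U) (d), (liftRel a p).rel ((powFrame L X).obj.map f.op s) d ↔
      ∃ x, d ≤ p.app x ⊓ IFrame.ap a (s.app f x) := fun V f d => by
    change (∃ x, _ ≤ p.app x ⊓ IFrame.ap a ((s.pull f).app (𝟙 V) x)) ↔ _
    simp only [s.pull_app_id]
  refine (liftRel a p).ap_hom_le_iff.trans ⟨fun H V f x => H f _ ((rel_iff f _).2 ⟨x, le_rfl⟩), ?_⟩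
  intro H V f d h
  obtain ⟨x, hd⟩ := (rel_iff f d).1 h
  exact hd.trans (H f x)

theorem inf_le_powAp_liftHom (s : PowSection L X U) (x : X.obj (op U)) :
    p.app x ⊓ IFrame.ap a (s.app (𝟙 U) x) ≤ powAp (liftHom a p) s :=
  (liftRel a p).le_ap_hom ⟨x, le_rfl⟩

theorem constHom_liftHom : constHom L X ≫ liftHom a p = a := by
  refine IFrame.hom_ext fun U m => ?_
  change powAp (liftHom a p) (constSection X m) = _
  apply le_antisymm
  · refine (powAp_liftHom_le_iff a p).2 fun V f x => ?_
    rw [constSection_app, IFrame.ap_map]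
    exact inf_le_right
  · refine p.le_of_forall fun V f x => ?_
    have := inf_le_powAp_liftHom a p ((constSection X m).pull f) x
    rwa [PowSection.pull_app_id, constSection_app, IFrame.ap_map, ← map_powAp] at this

theorem powAp_liftHom_diagSection (x : X.obj (op U)) :
    powAp (liftHom a p) (diagSection L x) = p.app x := by
  apply le_antisymm
  · refine (powAp_liftHom_le_iff a p).2 fun V f x' => ?_
    rw [diagSection_app, IFrame.ap_eqv, inf_comm, ← p.nat]
    exact p.eqv_inf_le _ _
  · have := inf_le_powAp_liftHom a p (diagSection L x) x
    rwa [diagSection_app_self, IFrame.ap_top, inf_top_eq] at this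

theorem eq_liftHom (ψ : powFrame L X ⟶ T) (ha : constHom L X ≫ ψ = a)
    (hp : ∀ ⦃U : C⦄ (x : X.obj (op U)), powAp ψ (diagSection L x) = p.app x) :
    ψ = liftHom a p := by
  have inf_powAp : ∀ ⦃U : C⦄ (s : PowSection L X U) (x : X.obj (op U)),
      p.app x ⊓ powAp ψ s = p.app x ⊓ IFrame.ap a (s.app (𝟙 U) x) := by
    intro U s x
    have map_const : IFrame.ap a (s.app (𝟙 U) x) =
        powAp ψ (constSection X (s.app (𝟙 U) x)) := by
      rw [← ha]
      rfl
    rw [map_const, ← hp, ← powAp_inf, ← powAp_inf, diagSection_inf_constSection]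
  refine IFrame.hom_ext fun U (s : PowSection L X U) => ?_
  change powAp ψ s = powAp (liftHom a p) s
  apply le_antisymm
  · refine p.le_of_forall fun V f x => ?_
    rw [map_powAp, map_powAp, inf_powAp]
    exact inf_le_powAp_liftHom a p (s.pull f) x
  · refine (powAp_liftHom_le_iff a p).2 fun V f x => ?_
    rw [map_powAp, ← s.pull_app_id, ← inf_powAp]
    exact inf_le_right

end LiftHom

/-- The product of a locale with a discrete space. -/
noncomputable def prodFan (Z : ILocale J) (X : Sheaf J (Type u)) : BinaryFan Z (discrete X) :=
  BinaryFan.mk (P := op (powFrame Z.unop X.obj)) (constHom Z.unop X.obj).op (diagHom Z.unop X).op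

/-- The universal property of `prodFan`. -/
noncomputable def prodFanIsLimit (Z : ILocale J) (X : Sheaf J (Type u)) : IsLimit (prodFan Z X) :=
  BinaryFan.IsLimit.mk _ (fun f g => (liftHom f.unop (.ofHom g.unop)).op)
    (fun f g => congrArg Quiver.Hom.op (constHom_liftHom f.unop (.ofHom g.unop)))
    (fun f g => congrArg Quiver.Hom.op <| power_hom_ext fun _ x =>
      (congrArg (IFrame.ap (liftHom f.unop (.ofHom g.unop))) (ap_diagHom_point x)).trans
        (powAp_liftHom_diagSection f.unop (.ofHom g.unop) x))
    (fun f g m hf hg => congrArg Quiver.Hom.op <| eq_liftHom f.unop (.ofHom g.unop) m.unop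
      (congrArg Quiver.Hom.unop hf) fun _ x =>
        (congrArg (IFrame.ap m.unop) (ap_diagHom_point x).symm).trans
          (congrArg (fun φ => IFrame.ap φ (point X x)) (congrArg Quiver.Hom.unop hg)))

end DiscreteProduct

noncomputable section GraphOpens

/-- A finite set of pairs `(x, y)`, standing for the meet of the opens `{θ | θ x = y}`. -/
abbrev Word (X Y : Cᵒᵖ ⥤ Type u) (U : C) : Type u := Finset (X.obj (op U) × Y.obj (op U))

variable {X Y : Cᵒᵖ ⥤ Type u} {U V W : C}

instance : DecidableEq (X.obj (op U) × Y.obj (op U)) := Classical.decEq _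

/-- Restriction of words. -/
def res (f : V ⟶ U) (l : Word X Y U) : Word X Y V :=
  l.image fun p => (X.map f.op p.1, Y.map f.op p.2)

theorem res_empty (f : V ⟶ U) : res f (∅ : Word X Y U) = ∅ := rfl

theorem res_singleton (f : V ⟶ U) (x : X.obj (op U)) (y : Y.obj (op U)) :
    res f {(x, y)} = {(X.map f.op x, Y.map f.op y)} :=
  Finset.image_singleton _ _

theorem res_insert (f : V ⟶ U) (x : X.obj (op U)) (y : Y.obj (op U)) (l : Word X Y U) :
    res f (insert (x, y) l) = insert (X.map f.op x, Y.map f.op y) (res f l) :=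
  Finset.image_insert _ _ _

theorem res_union (f : V ⟶ U) (l l' : Word X Y U) : res f (l ∪ l') = res f l ∪ res f l' :=
  Finset.image_union _ _

theorem res_subset (f : V ⟶ U) {l l' : Word X Y U} (h : l ⊆ l') : res f l ⊆ res f l' :=
  Finset.image_subset_image h

theorem mem_res (f : V ⟶ U) {x : X.obj (op U)} {y : Y.obj (op U)} {l : Word X Y U}
    (h : (x, y) ∈ l) : (X.map f.op x, Y.map f.op y) ∈ res f l :=
  Finset.mem_image_of_mem _ h

theorem res_id (l : Word X Y U) : res (𝟙 U) l = l := by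
  simp [res]

theorem res_res (f : V ⟶ U) (g : W ⟶ V) (l : Word X Y U) : res g (res f l) = res (g ≫ f) l := by
  simp [res, Finset.image_image, Function.comp_def]

/-- An open over the stage `U` of the locale of functional relations between `X` and `Y`: a family
of words, to be thought of as the words below the open, which is closed under the rules valid for
a functional relation. -/
@[ext]
structure GraphOpen (J : GrothendieckTopology C) (X Y : Cᵒᵖ ⥤ Type u) (U : C) where
  /-- The words lying below the restriction of the open along `f : V ⟶ U`. -/
  Mem : ∀ ⦃V : C⦄, (V ⟶ U) → Word X Y V → Prop
  restrict : ∀ ⦃V : C⦄ {f : V ⟶ U} {l}, Mem f l → ∀ ⦃W : C⦄ (g : W ⟶ V), Mem (g ≫ f) (res g l)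
  isLocal : ∀ ⦃V : C⦄ {f : V ⟶ U} {l} {R : Sieve V}, R ∈ J V →
    (∀ ⦃W : C⦄ (g : W ⟶ V), R g → Mem (g ≫ f) (res g l)) → Mem f l
  mono : ∀ ⦃V : C⦄ {f : V ⟶ U} {l l'}, l ⊆ l' → Mem f l → Mem f l'
  total : ∀ ⦃V : C⦄ {f : V ⟶ U} {l} (x : X.obj (op V)),
    (∀ ⦃W : C⦄ (g : W ⟶ V) (y : Y.obj (op W)),
      Mem (g ≫ f) (insert (X.map g.op x, y) (res g l))) → Mem f l
  single : ∀ ⦃V : C⦄ {f : V ⟶ U} {l} {x : X.obj (op V)} {y y' : Y.obj (op V)},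
    (x, y) ∈ l → (x, y') ∈ l →
    (∀ ⦃W : C⦄ (g : W ⟶ V), Y.map g.op y = Y.map g.op y' → Mem (g ≫ f) (res g l)) → Mem f l

namespace GraphOpen

variable {l l' : Word X Y U}

theorem ext_mem {I K : GraphOpen J X Y U}
    (h : ∀ ⦃V : C⦄ (f : V ⟶ U) (l : Word X Y V), I.Mem f l ↔ K.Mem f l) : I = K := by
  ext V f l
  exact h f l

instance : PartialOrder (GraphOpen J X Y U) where
  le I K := ∀ ⦃V : C⦄ (f : V ⟶ U) (l : Word X Y V), I.Mem f l → K.Mem f l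
  le_refl _ _ _ _ h := h
  le_trans _ _ _ h h' _ f l hl := h' f l (h f l hl)
  le_antisymm _ _ h h' := ext_mem fun _ f l => ⟨h f l, h' f l⟩

instance : InfSet (GraphOpen J X Y U) where
  sInf s :=
    { Mem := fun _ f l => ∀ I ∈ s, I.Mem f l
      restrict := fun _ _ _ h _ g I hI => I.restrict (h I hI) g
      isLocal := fun _ _ _ _ hR h I hI => I.isLocal hR fun _ g hg => h g hg I hI
      mono := fun _ _ _ _ hl h I hI => I.mono hl (h I hI)
      total := fun _ _ _ x h I hI => I.total x fun _ g y => h g y I hI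
      single := fun _ _ _ _ _ _ hy hy' h I hI => I.single hy hy' fun _ g hg => h g hg I hI }

instance : CompleteLattice (GraphOpen J X Y U) where
  __ := completeLatticeOfInf (GraphOpen J X Y U) fun _ =>
    ⟨fun I hI _ _ _ h => h I hI, fun _ hK _ f l hl _ hI => hK hI f l hl⟩
  inf I K :=
    { Mem := fun _ f l => I.Mem f l ∧ K.Mem f l
      restrict := fun _ _ _ h _ g => ⟨I.restrict h.1 g, K.restrict h.2 g⟩
      isLocal := fun _ _ _ _ hR h =>
        ⟨I.isLocal hR fun _ g hg => (h g hg).1, K.isLocal hR fun _ g hg => (h g hg).2⟩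
      mono := fun _ _ _ _ hl h => ⟨I.mono hl h.1, K.mono hl h.2⟩
      total := fun _ _ _ x h =>
        ⟨I.total x fun _ g y => (h g y).1, K.total x fun _ g y => (h g y).2⟩
      single := fun _ _ _ _ _ _ hy hy' h =>
        ⟨I.single hy hy' fun _ g hg => (h g hg).1, K.single hy hy' fun _ g hg => (h g hg).2⟩ }
  inf_le_left _ _ _ _ _ h := h.1
  inf_le_right _ _ _ _ _ h := h.2
  le_inf _ _ _ h h' _ f l hl := ⟨h f l hl, h' f l hl⟩

/-- Restriction of graph opens. -/
def pull (h : V ⟶ U) (I : GraphOpen J X Y U) : GraphOpen J X Y V where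
  Mem _ f l := I.Mem (f ≫ h) l
  restrict _ f l hl _ g := by simpa using I.restrict hl g
  isLocal _ f l R hR hl := I.isLocal hR (by simpa using hl)
  mono _ _ _ _ hl := I.mono hl
  total _ f l x hl := I.total x (by simpa using hl)
  single _ f l x y y' hy hy' hl := I.single hy hy' (by simpa using hl)

theorem mem_pull {h : V ⟶ U} {I : GraphOpen J X Y U} {f : W ⟶ V} {l : Word X Y W} :
    (I.pull h).Mem f l ↔ I.Mem (f ≫ h) l := Iff.rfl

theorem mem_pull_id {f : V ⟶ U} {I : GraphOpen J X Y U} {l : Word X Y V} :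
    (I.pull f).Mem (𝟙 V) l ↔ I.Mem f l := by
  rw [mem_pull, Category.id_comp]

theorem pull_id (I : GraphOpen J X Y U) : I.pull (𝟙 U) = I :=
  ext_mem fun V f l => by rw [mem_pull, Category.comp_id]

theorem pull_pull (f : V ⟶ U) (g : W ⟶ V) (I : GraphOpen J X Y U) :
    (I.pull f).pull g = I.pull (g ≫ f) :=
  ext_mem fun W' k l => by rw [mem_pull, mem_pull, mem_pull, Category.assoc]

/-- The right adjoint of restriction along `h`. -/
def forallAlong (h : V ⟶ U) (I : GraphOpen J X Y V) : GraphOpen J X Y U where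
  Mem _ f l := ∀ ⦃W⦄ (g : W ⟶ _) (k : W ⟶ V), g ≫ f = k ≫ h → I.Mem k (res g l)
  restrict _ f l hl _ g _ g' k e := by
    rw [res_res]
    exact hl _ k (by rw [Category.assoc, e])
  isLocal _ f l R hR hl W g k e := I.isLocal (J.pullback_stable g hR) fun W' g' hg' => by
    simpa [res_id, res_res] using hl (g' ≫ g) hg' (𝟙 W') (g' ≫ k) (by simp [e])
  mono _ f l l' h hl W g k e := I.mono (res_subset g h) (hl g k e)
  total _ f l x hl W g k e := I.total (X.map g.op x) fun W' g' y => by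
    simpa [res_id, res_res, res_insert] using hl (g' ≫ g) y (𝟙 W') (g' ≫ k) (by simp [e])
  single _ f l x y y' hy hy' hl W g k e :=
    I.single (mem_res g hy) (mem_res g hy') fun W' g' hg' => by
      rw [map_map, map_map] at hg'
      simpa [res_id, res_res] using hl (g' ≫ g) hg' (𝟙 W') (g' ≫ k) (by simp [e])

theorem gc_pull_forallAlong (h : V ⟶ U) :
    GaloisConnection (pull h : GraphOpen J X Y U → _) (forallAlong h) := by
  refine fun I K => ⟨fun H W f l hl W' g k e => ?_, fun H W f l hl => ?_⟩
  · refine H k _ (mem_pull.2 ?_)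
    rw [← e]
    exact I.restrict hl g
  · simpa [res_id] using H (f ≫ h) l hl (𝟙 W) f (Category.id_comp _)

/-- The largest graph open whose meet with the word `w` lies below `I`. -/
def shift (w : Word X Y U) (I : GraphOpen J X Y U) : GraphOpen J X Y U where
  Mem _ f l := I.Mem f (l ∪ res f w)
  restrict _ f l hl _ g := by simpa [res_union, res_res] using I.restrict hl g
  isLocal _ f l R hR hl := I.isLocal hR (by simpa [res_union, res_res] using hl)
  mono _ f l l' h hl := I.mono (Finset.union_subset_union_left h) hl
  total _ f l x hl := I.total x (by simpa [res_union, res_res] using hl)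
  single _ f l x y y' hy hy' hl := I.single (Finset.mem_union_left _ hy)
    (Finset.mem_union_left _ hy') (by simpa [res_union, res_res] using hl)

theorem mem_shift {w : Word X Y U} {I : GraphOpen J X Y U} {f : V ⟶ U} {l : Word X Y V} :
    (shift w I).Mem f l ↔ I.Mem f (l ∪ res f w) := Iff.rfl

/-- Heyting implication. -/
def imp (I K : GraphOpen J X Y U) : GraphOpen J X Y U :=
  sInf {M | ∃ (V : C) (f : V ⟶ U) (w : Word X Y V), I.Mem f w ∧
    M = forallAlong f (shift w (K.pull f))}

theorem le_pull_imp_iff {I K : GraphOpen J X Y U} (h : V ⟶ U) {M : GraphOpen J X Y V} :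
    M ≤ (imp I K).pull h ↔ M ⊓ I.pull h ≤ K.pull h := by
  constructor
  · rintro H W f l ⟨hM, hI⟩
    simpa [res_id, mem_shift, mem_pull] using
      H f l hM _ ⟨W, f ≫ h, l, hI, rfl⟩ (𝟙 W) (𝟙 W) rfl
  · rintro H W f l hM _ ⟨V', f', w, hw, rfl⟩ W' g k e
    rw [mem_shift, mem_pull, ← e, ← Category.assoc]
    refine H _ _ ⟨M.mono Finset.subset_union_left (M.restrict hM g), ?_⟩
    rw [mem_pull, Category.assoc, e]
    exact I.mono Finset.subset_union_right (I.restrict hw k)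

theorem le_imp_iff {I K M : GraphOpen J X Y U} : M ≤ imp I K ↔ M ⊓ I ≤ K := by
  simpa only [pull_id] using le_pull_imp_iff (I := I) (K := K) (M := M) (𝟙 U)

instance : Order.Frame (GraphOpen J X Y U) := Order.Frame.ofMinimalAxioms
  { inf_sSup_le_iSup_inf := fun I s => by
      rw [inf_comm, ← le_imp_iff]
      refine sSup_le fun K hK => le_imp_iff.2 ?_
      rw [inf_comm]
      exact le_iSup₂_of_le K hK le_rfl }

/-- Restriction is a frame homomorphism. -/
def pullHom (h : V ⟶ U) : FrameHom (GraphOpen J X Y U) (GraphOpen J X Y V) where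
  toFun := pull h
  map_inf' _ _ := rfl
  map_top' := top_le_iff.1 fun _ _ _ _ _ h => h.elim
  map_sSup' s := by
    rw [(gc_pull_forallAlong h).l_sSup, sSup_image]

end GraphOpen

variable (J X Y) in
/-- The presheaf of graph opens. -/
def graphFrm : Cᵒᵖ ⥤ Frm.{u} where
  obj U := Frm.of (GraphOpen J X Y U.unop)
  map h := Frm.ofHom (GraphOpen.pullHom h.unop)
  map_id U := Frm.hom_ext (DFunLike.ext _ _ (GraphOpen.pull_id (U := U.unop)))
  map_comp f g := Frm.hom_ext (DFunLike.ext _ _ fun I =>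
    (GraphOpen.pull_pull f.unop g.unop I).symm)

namespace GraphOpen

theorem le_of_cover {I K : GraphOpen J X Y U} {R : Sieve U} (hR : R ∈ J U)
    (h : ∀ ⦃V : C⦄ (f : V ⟶ U), R f → I.pull f ≤ K.pull f) : I ≤ K :=
  fun V f l hl => K.isLocal (J.pullback_stable f hR) fun W g hg => by
    rw [← mem_pull_id]
    exact h _ hg _ _ (mem_pull_id.2 (I.restrict hl g))

theorem graphFrm_isSheaf : Presieve.IsSheaf J (graphFrm J X Y ⋙ forget Frm) := by
  intro U R hR K hK
  let K' : ∀ ⦃V : C⦄ (f : V ⟶ U), R f → GraphOpen J X Y V := fun V f h => K f h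
  have compatible : ∀ ⦃V V' W : C⦄ {f : V ⟶ U} (hf : R f) {f' : V' ⟶ U} (hf' : R f')
      (g : W ⟶ V) (g' : W ⟶ V'), g ≫ f = g' ≫ f' → (K' f hf).pull g = (K' f' hf').pull g' :=
    fun _ _ _ _ hf _ hf' g g' e => hK g g' hf hf' e
  let amalgam : GraphOpen J X Y U :=
    sInf {M | ∃ (V : C) (f : V ⟶ U) (h : R f), M = forallAlong f (K' f h)}
  have pull_amalgam : ∀ ⦃V : C⦄ (f : V ⟶ U) (h : R f), amalgam.pull f = K' f h := by
    intro V f hf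
    apply le_antisymm
    · exact (gc_pull_forallAlong f).l_le (sInf_le ⟨V, f, hf, rfl⟩)
    · rintro W g l hl _ ⟨V', f', hf', rfl⟩ W' k k' e
      rw [← mem_pull_id, ← compatible hf hf' (k ≫ g) k' (by simpa using e), mem_pull_id]
      exact (K' f hf).restrict hl k
  refine ⟨amalgam, pull_amalgam, fun (M : GraphOpen J X Y U) hM => ?_⟩
  have pull_eq : ∀ ⦃V : C⦄ (f : V ⟶ U), R f → M.pull f = amalgam.pull f :=
    fun V f h => (hM f h).trans (pull_amalgam f h).symm
  exact le_antisymm (α := GraphOpen J X Y U) (le_of_cover hR fun V f h => (pull_eq f h).le)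
    (le_of_cover hR fun V f h => (pull_eq f h).ge)

/-- The internal join of a family of graph opens. -/
def internalSup (Φ : SubFamily (graphFrm J X Y ⋙ forget Frm) U) : GraphOpen J X Y U :=
  sInf {K | ∀ ⦃V : C⦄ (f : V ⟶ U) (I : GraphOpen J X Y V), I ∈ Φ.carrier f → I ≤ K.pull f}

theorem isJoin_internalSup (Φ : SubFamily (graphFrm J X Y ⋙ forget Frm) U) :
    IsJoin (graphFrm J X Y) Φ (internalSup Φ) := by
  refine .of_le (fun V f (I : GraphOpen J X Y V) hI W g l hl K hK => hK f I hI g l hl)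
    fun V f (K : GraphOpen J X Y V) hK => (gc_pull_forallAlong f).l_le (sInf_le ?_)
  intro W g (I : GraphOpen J X Y W) hI W' g' l hl W'' k k' e
  have : I.pull (k ≫ g') ∈ Φ.carrier (k' ≫ f) := by
    rw [← e, ← Category.assoc]
    exact Φ.restrict g I hI (k ≫ g')
  exact mem_pull_id.1 (hK k' _ this (𝟙 W'') _ (mem_pull_id.2 (I.restrict hl k)))

end GraphOpen

variable (J X Y) in
/-- The frame of opens of the locale of functional relations between `X` and `Y`. -/
def graphFrame : IFrame J where
  obj := graphFrm J X Y
  isSheaf := GraphOpen.graphFrm_isSheaf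
  exists_isJoin Φ := ⟨_, GraphOpen.isJoin_internalSup Φ⟩
  inf_isJoin {U} Φ s t h := by
    refine .of_le ?_ fun V f (b : GraphOpen J X Y V) H => ?_
    · rintro V f _ ⟨a, ha, rfl⟩
      rw [map_inf]
      exact inf_le_inf_right _ (h.le ha)
    · rw [map_inf]
      refine GraphOpen.le_imp_iff.1 ((h f _).2 fun W g (a : GraphOpen J X Y W) ha => ?_)
      refine (GraphOpen.le_pull_imp_iff g).2 (H g _ ⟨a, ha, ?_⟩)
      rw [← map_map]
      rfl

end GraphOpens

noncomputable section FunctionalRelations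

namespace GraphOpen

variable {X Y : Cᵒᵖ ⥤ Type u} {U V W : C} {l l' : Word X Y U}

variable (J) in
/-- The graph open generated by a word. -/
def principal (l : Word X Y U) : GraphOpen J X Y U := sInf {I | I.Mem (𝟙 U) l}

theorem mem_principal_self (l : Word X Y U) : (principal J l).Mem (𝟙 U) l := fun _ h => h

theorem principal_le_iff {I : GraphOpen J X Y U} : principal J l ≤ I ↔ I.Mem (𝟙 U) l :=
  ⟨fun h => h _ _ (mem_principal_self l), fun h => sInf_le h⟩

theorem pull_principal (f : V ⟶ U) : (principal J l).pull f = principal J (res f l) := by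
  apply le_antisymm
  · refine (gc_pull_forallAlong f).l_le (principal_le_iff.2 fun W g k e => ?_)
    rw [Category.comp_id] at e
    rw [e, ← res_res]
    simpa using (principal J (res f l)).restrict (mem_principal_self _) k
  · refine principal_le_iff.2 (mem_pull_id.2 ?_)
    simpa using (principal J l).restrict (mem_principal_self l) f

theorem principal_inf_le_iff {I K : GraphOpen J X Y U} : principal J l ⊓ K ≤ I ↔ K ≤ shift l I := by
  constructor
  · intro h V f w hw
    have mem_principal : (principal J l).Mem f (res f l) := by
      simpa using (principal J l).restrict (mem_principal_self l) f
    exact h f _ ⟨(principal J l).mono Finset.subset_union_right mem_principal,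
      K.mono Finset.subset_union_left hw⟩
  · rintro h V f w ⟨hl, hw⟩
    have principal_le : (principal J l).pull f ≤ shift w (I.pull f) := by
      rw [pull_principal, principal_le_iff, mem_shift, mem_pull_id, res_id, Finset.union_comm]
      exact h f w hw
    simpa [mem_shift, mem_pull, res_id] using principal_le (𝟙 V) w (mem_pull_id.2 hl)

theorem principal_empty : principal J (∅ : Word X Y U) = ⊤ :=
  top_le_iff.1 fun V f l _ => (principal J ∅).mono (Finset.empty_subset l) <| by
    simpa [res_empty] using (principal J (∅ : Word X Y U)).restrict (mem_principal_self ∅) f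

theorem principal_union : principal J (l ∪ l') = principal J l ⊓ principal J l' := by
  apply le_antisymm
  · exact le_inf
      (principal_le_iff.2 ((principal J l).mono Finset.subset_union_left (mem_principal_self l)))
      (principal_le_iff.2 ((principal J l').mono Finset.subset_union_right (mem_principal_self l')))
  · rw [principal_inf_le_iff, principal_le_iff, mem_shift, res_id, Finset.union_comm]
    exact mem_principal_self _

variable (J) in
/-- The open `{θ | θ x = y}`. -/
def gen (x : X.obj (op U)) (y : Y.obj (op U)) : GraphOpen J X Y U := principal J {(x, y)}

theorem pull_gen (f : V ⟶ U) (x : X.obj (op U)) (y : Y.obj (op U)) :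
    (gen J x y).pull f = gen J (X.map f.op x) (Y.map f.op y) := by
  rw [gen, pull_principal, res_singleton, gen]

theorem gen_le_iff {I : GraphOpen J X Y U} {x : X.obj (op U)} {y : Y.obj (op U)} :
    gen J x y ≤ I ↔ I.Mem (𝟙 U) {(x, y)} :=
  principal_le_iff

theorem principal_eq_inf_gen (l : Word X Y U) :
    principal J l = l.inf fun p => gen J p.1 p.2 := by
  induction l using Finset.induction_on with
  | empty => exact principal_empty
  | insert p l _ ih => rw [Finset.insert_eq, principal_union, ih, ← Finset.insert_eq,
      Finset.inf_insert, gen]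

/-- The principal graph opens below `I`. -/
def principalFamily (I : GraphOpen J X Y U) : SubFamily (graphFrm J X Y ⋙ forget Frm) U where
  carrier V f := {K | ∃ l, I.Mem f l ∧ K = principal J l}
  restrict := by
    rintro V f _ ⟨l, hl, rfl⟩ W g
    exact ⟨res g l, I.restrict hl g, pull_principal g⟩

theorem isJoin_principalFamily (I : GraphOpen J X Y U) :
    IsJoin (graphFrm J X Y) (principalFamily I) I := by
  refine .of_le ?_ fun V f (b : GraphOpen J X Y V) H W g l hl => ?_
  · rintro V f _ ⟨l, hl, rfl⟩
    exact principal_le_iff.2 (mem_pull_id.2 hl)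
  · exact mem_pull_id.1 (principal_le_iff.1 (H g _ ⟨l, hl, rfl⟩))

theorem hom_ext {L : IFrame J} {φ ψ : graphFrame J X Y ⟶ L}
    (h : ∀ ⦃U : C⦄ (x : X.obj (op U)) (y : Y.obj (op U)),
      IFrame.ap φ (U := U) (gen J x y) = IFrame.ap ψ (U := U) (gen J x y)) : φ = ψ := by
  have ap_principal : ∀ (χ : graphFrame J X Y ⟶ L) ⦃U : C⦄ (l : Word X Y U),
      IFrame.ap χ (U := U) (principal J l) =
        l.inf fun p => IFrame.ap χ (U := U) (gen J p.1 p.2) := fun χ U l => by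
    rw [principal_eq_inf_gen]
    exact map_finset_inf (χ.hom.app (op U)).hom l _
  refine IFrame.hom_ext fun U (I : GraphOpen J X Y U) => eq_of_forall_ge_iff fun b => ?_
  rw [IFrame.ap_isJoin_le_iff φ (isJoin_principalFamily I),
    IFrame.ap_isJoin_le_iff ψ (isJoin_principalFamily I)]
  refine forall₃_congr fun V f K => forall_congr' ?_
  rintro ⟨l, -, rfl⟩
  rw [ap_principal φ, ap_principal ψ]
  simp only [h]

end GraphOpen

/-- A functional relation between `X` and `Y` in the logic of the frame `L`: the opens
`{z | g (z, x) = y}` for a map `g : Z × X ⟶ Y`, where `L` is the frame of opens of `Z`. -/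
structure FunctionalRelation (X Y : Cᵒᵖ ⥤ Type u) (L : IFrame J) where
  /-- The truth value of `(x, y)` in `L`. -/
  app : ∀ ⦃U : C⦄, X.obj (op U) → Y.obj (op U) → L.obj.obj (op U)
  nat : ∀ ⦃U V : C⦄ (f : V ⟶ U) (x : X.obj (op U)) (y : Y.obj (op U)),
    app (X.map f.op x) (Y.map f.op y) = L.obj.map f.op (app x y)
  total : ∀ ⦃U : C⦄ (x : X.obj (op U)) (b : L.obj.obj (op U)),
    (∀ ⦃V : C⦄ (f : V ⟶ U) (y : Y.obj (op V)), app (X.map f.op x) y ≤ L.obj.map f.op b) → ⊤ ≤ b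
  single : ∀ ⦃U : C⦄ (x : X.obj (op U)) (y y' : Y.obj (op U)), app x y ⊓ app x y' ≤ L.eqv y y'

namespace FunctionalRelation

variable {X Y : Cᵒᵖ ⥤ Type u} {L : IFrame J} {U V W : C}

section Classify

variable (R : FunctionalRelation X Y L)

theorem le_of_forall (x : X.obj (op U)) {t b : L.obj.obj (op U)}
    (h : ∀ ⦃V : C⦄ (f : V ⟶ U) (y : Y.obj (op V)),
      R.app (X.map f.op x) y ⊓ L.obj.map f.op t ≤ L.obj.map f.op b) : t ≤ b := by
  let values : SubFamily (L.obj ⋙ forget Frm) U :=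
    { carrier := fun V f => Set.range (R.app (X.map f.op x))
      restrict := by
        rintro V f _ ⟨y, rfl⟩ W g
        exact ⟨Y.map g.op y, by rw [← map_map, R.nat]; rfl⟩ }
  refine IFrame.le_of_forall_inf_le values (fun c hc => R.total x c fun V f y => hc f _ ⟨y, rfl⟩) ?_
  rintro V f _ ⟨y, rfl⟩
  exact h f y

/-- The value of a word: the meet of the values of its members. -/
def word (l : Word X Y U) : L.obj.obj (op U) := l.inf fun p => R.app p.1 p.2

theorem map_word (f : V ⟶ U) (l : Word X Y U) : L.obj.map f.op (R.word l) = R.word (res f l) := by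
  rw [word, word, res, Finset.inf_image]
  refine (map_finset_inf (L.obj.map f.op).hom l _).trans (Finset.inf_congr rfl fun p _ => ?_)
  exact (R.nat f p.1 p.2).symm

/-- The words whose value lies below `b`. -/
def below (b : L.obj.obj (op U)) : GraphOpen J X Y U where
  Mem _ f l := R.word l ≤ L.obj.map f.op b
  restrict _ f l h _ g := by
    rw [← R.map_word, ← map_map]
    exact map_mono _ g h
  isLocal _ f l S hS h := L.le_of_cover hS fun W g hg => by
    rw [R.map_word, map_map]
    exact h g hg
  mono _ _ _ _ h hl := (Finset.inf_mono h).trans hl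
  total _ f l x h := R.le_of_forall x fun W g y => by
    rw [R.map_word, map_map]
    simpa only [word, Finset.inf_insert] using h g y
  single _ f l x y y' hy hy' h := by
    have word_le_eqv : R.word l ≤ L.eqv y y' :=
      (le_inf (Finset.inf_le hy) (Finset.inf_le hy')).trans (R.single x y y')
    refine (le_inf word_le_eqv le_rfl).trans (IFrame.eqv_inf_le_iff.2 fun W g e => ?_)
    rw [R.map_word, map_map]
    exact h g e

theorem mem_below {b : L.obj.obj (op U)} {f : V ⟶ U} {l : Word X Y V} :
    (R.below b).Mem f l ↔ R.word l ≤ L.obj.map f.op b :=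
  Iff.rfl

theorem mem_below_id {b : L.obj.obj (op U)} {l : Word X Y U} :
    (R.below b).Mem (𝟙 U) l ↔ R.word l ≤ b := by
  rw [mem_below, op_id, Functor.map_id_apply]

/-- The frame homomorphism classifying a functional relation: an approximation to its value at `I`
is the value of a word lying below `I`. -/
def approximableRel : ApproximableRel (graphFrame J X Y) L where
  rel U (I : GraphOpen J X Y U) a := ∃ l, I.Mem (𝟙 U) l ∧ a = R.word l
  restrict := by
    rintro U V f (I : GraphOpen J X Y U) _ ⟨l, hl, rfl⟩
    exact ⟨res f l, GraphOpen.mem_pull_id.2 (by simpa using I.restrict hl f), R.map_word f l⟩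
  mono := by
    rintro U I I' _ h ⟨l, hl, rfl⟩
    exact ⟨l, h _ _ hl, rfl⟩
  top U b h := by
    simpa [word] using h (𝟙 U) _ ⟨∅, fun _ h => h.elim, rfl⟩
  inf := by
    rintro U (I : GraphOpen J X Y U) (I' : GraphOpen J X Y U) _ _ b ⟨l, hl, rfl⟩ ⟨l', hl', rfl⟩ h
    have mem_inf : (I ⊓ I').Mem (𝟙 U) (l ∪ l') :=
      ⟨I.mono Finset.subset_union_left hl, I'.mono Finset.subset_union_right hl'⟩
    rw [word, word, ← Finset.inf_union]
    simpa [word] using h (𝟙 U) _ ⟨l ∪ l', GraphOpen.mem_pull_id.2 mem_inf, rfl⟩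
  join := by
    rintro U Φ (I : GraphOpen J X Y U) _ b hI ⟨l, hl, rfl⟩ h
    refine R.mem_below_id.1 ((hI.le_iff (b := R.below b)).2 ?_ _ _ hl)
    intro V f (K : GraphOpen J X Y V) hK W g w hw
    exact h _ _ _ (Φ.restrict f K hK g) ⟨w, GraphOpen.mem_pull_id.2 hw, rfl⟩

/-- The frame homomorphism classifying a functional relation. -/
def hom : graphFrame J X Y ⟶ L := R.approximableRel.hom

theorem ap_hom_gen (x : X.obj (op U)) (y : Y.obj (op U)) :
    IFrame.ap R.hom (U := U) (GraphOpen.gen J x y) = R.app x y := by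
  have word_singleton : ∀ ⦃V : C⦄ (x : X.obj (op V)) (y : Y.obj (op V)),
      R.word {(x, y)} = R.app x y := fun _ _ _ => Finset.inf_singleton
  apply le_antisymm
  · refine R.approximableRel.ap_hom_le_iff.2 ?_
    rintro V f _ ⟨l, hl, rfl⟩
    have gen_le : GraphOpen.gen J x y ≤ R.below (R.app x y) :=
      GraphOpen.gen_le_iff.2 (R.mem_below_id.2 (word_singleton x y).le)
    exact gen_le f l (GraphOpen.mem_pull_id.1 hl)
  · exact R.approximableRel.le_ap_hom
      ⟨{(x, y)}, GraphOpen.mem_principal_self _, (word_singleton x y).symm⟩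

end Classify

variable (J X Y) in
/-- The functional relation of the opens `{θ | θ x = y}`. -/
def generic : FunctionalRelation X Y (graphFrame J X Y) where
  app U x y := (GraphOpen.gen J x y : GraphOpen J X Y U)
  nat _ _ f x y := (GraphOpen.pull_gen f x y).symm
  total U x (b : GraphOpen J X Y U) h V f l _ := b.total (X.map f.op x) fun W g y => by
    rw [map_map]
    exact b.mono (Finset.singleton_subset_iff.2 (Finset.mem_insert_self _ _))
      (GraphOpen.mem_pull_id.1 (GraphOpen.gen_le_iff.1 (h (g ≫ f) y)))
  single U x y y' := by
    let b : GraphOpen J X Y U := (graphFrame J X Y).eqv y y'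
    change GraphOpen.gen J x y ⊓ GraphOpen.gen J x y' ≤ b
    rw [GraphOpen.gen, GraphOpen.gen, ← GraphOpen.principal_union, GraphOpen.principal_le_iff]
    refine b.single (x := x) (y := y) (y' := y') (by simp) (by simp) fun V f e => ?_
    have pull_eq_top : b.pull f = (⊤ : GraphOpen J X Y V) := by
      refine ((graphFrame J X Y).map_eqv f y y').trans ?_
      rw [e, IFrame.eqv_self]
      rfl
    rw [Category.comp_id, ← GraphOpen.mem_pull_id, pull_eq_top]
    exact fun _ h => h.elim

end FunctionalRelation

end FunctionalRelations

section Currying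

variable {X Y : Cᵒᵖ ⥤ Type u} {L : IFrame J} {U V : C}

namespace IPartition

variable (p : IPartition Y (powFrame L X))

/-- A member of a partition of `L ^ X`, as a section. -/
def sec (y : Y.obj (op U)) : PowSection L X U := p.app y

theorem sec_map (f : V ⟶ U) (y : Y.obj (op U)) : p.sec (Y.map f.op y) = (p.sec y).pull f :=
  p.nat f y

end IPartition

namespace FunctionalRelation

/-- The map `Z × X ⟶ Y` with a given functional relation, as a partition indexed by `Y`. -/
def partition (R : FunctionalRelation X Y L) : IPartition Y (powFrame L X) where
  app U y := show PowSection L X U from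
    { app := fun _ f x => R.app x (Y.map f.op y)
      nat := fun _ _ f g x => by
        rw [← map_map, R.nat] }
  nat U V f y := PowSection.ext_app (L := L) (X := X) fun W g x =>
    congrArg (R.app x) (map_map Y f g y)
  total U (b : PowSection L X U) h V f x := R.total x (b.app f x) fun W g y => by
    have : R.app (X.map g.op x) (Y.map (𝟙 W).op y) ≤ (b.pull (g ≫ f)).app (𝟙 W) (X.map g.op x) :=
      h (g ≫ f) y (𝟙 W) (X.map g.op x)
    rwa [op_id, Functor.map_id_apply, b.pull_app_id, b.nat] at this
  disjoint U y y' V f x := (R.single x _ _).trans_eq (powFrame_eqv_app y y' f x).symm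

theorem partition_sec_app (R : FunctionalRelation X Y L) (y : Y.obj (op U)) (f : V ⟶ U)
    (x : X.obj (op V)) : (R.partition.sec y).app f x = R.app x (Y.map f.op y) := rfl

/-- The functional relation of a map `Z × X ⟶ Y`, given as a partition indexed by `Y`. -/
def ofPartition (p : IPartition Y (powFrame L X)) : FunctionalRelation X Y L where
  app U x y := (p.sec y).app (𝟙 U) x
  nat U V f x y := by
    rw [p.sec_map, PowSection.pull_app_id, PowSection.app_eq_map]
  total U x b h := by
    have diag_le : diagSection L x ≤ constSection X b := p.le_of_forall fun V f y => by
      change p.sec y ⊓ (diagSection L x).pull f ≤ (constSection X b).pull f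
      rw [inf_comm, pull_diagSection, diagSection_inf_le_iff, PowSection.pull_app_id]
      exact h f y
    simpa only [diagSection_app_self, constSection_app, op_id, Functor.map_id_apply]
      using diag_le (𝟙 U) x
  single U x y y' := (p.disjoint y y' (𝟙 U) x).trans_eq <|
    (powFrame_eqv_app y y' (𝟙 U) x).trans <| by
      simp only [op_id, Functor.map_id_apply]

end FunctionalRelation

end Currying

noncomputable section Exponential

variable {L M : IFrame J} {X Y : Sheaf J (Type u)} {U V : C}

theorem app_powAp_liftHom (h : L ⟶ M) (s : PowSection L X.obj U) (f : V ⟶ U)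
    (x : X.obj.obj (op V)) :
    PowSection.app (powAp (liftHom (h ≫ constHom M X.obj) (.ofHom (diagHom M X))) s) f x =
      IFrame.ap h (s.app f x) := by
  let p : IPartition X.obj (powFrame M X.obj) := .ofHom (diagHom M X)
  let ψ := liftHom (h ≫ constHom M X.obj) p
  have powAp_diag : (powAp ψ (diagSection L x) : PowSection M X.obj V) = diagSection M x :=
    (powAp_liftHom_diagSection _ p x).trans (ap_diagHom_point x)
  have powAp_const : (powAp ψ (constSection X.obj (s.app f x)) : PowSection M X.obj V) =
      constSection X.obj (IFrame.ap h (s.app f x)) :=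
    congrArg (IFrame.ap · (s.app f x)) (constHom_liftHom (h ≫ constHom M X.obj) p)
  let t : PowSection M X.obj V := powAp ψ (s.pull f)
  have inf_powAp : diagSection M x ⊓ t =
      diagSection M x ⊓ constSection X.obj (IFrame.ap h (s.app f x)) := by
    rw [← powAp_diag, ← powAp_const, ← s.pull_app_id]
    refine (powAp_inf ψ _ _).symm.trans (Eq.trans ?_ (powAp_inf ψ _ _))
    rw [diagSection_inf_constSection]
  have app_t : t.app (𝟙 V) x = IFrame.ap h (s.app f x) := by
    simpa only [PowSection.inf_app, diagSection_app_self, top_inf_eq, constSection_app, op_id,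
      Functor.map_id_apply] using congrArg (PowSection.app · (𝟙 V) x) inf_powAp
  exact (PowSection.pull_app_id f (powAp ψ s) x).symm.trans <|
    (congrArg (PowSection.app · (𝟙 V) x) (map_powAp ψ f s)).trans app_t

/-- The exponential `Y ^ X` of discrete spaces. -/
def graphLocale (X Y : Sheaf J (Type u)) : ILocale J := op (graphFrame J X.obj Y.obj)

/-- The frame homomorphism of the evaluation map. -/
def evalHom (X Y : Sheaf J (Type u)) : power Y ⟶ powFrame (graphFrame J X.obj Y.obj) X.obj :=
  (FunctionalRelation.generic J X.obj Y.obj).partition.hom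

theorem ap_evalHom_point (y : Y.obj.obj (op U)) :
    IFrame.ap (evalHom X Y) (point Y y) =
      (FunctionalRelation.generic J X.obj Y.obj).partition.sec y :=
  IPartition.ap_hom_point _ y

/-- The evaluation map `Y ^ X × X ⟶ Y`. -/
def evalMap (X Y : Sheaf J (Type u)) : (prodFan (graphLocale X Y) X).pt ⟶ discrete Y :=
  Quiver.Hom.op (X := power Y) (Y := powFrame (graphFrame J X.obj Y.obj) X.obj) (evalHom X Y)

theorem evalHom_comp_liftHom_eq_iff (h : graphFrame J X.obj Y.obj ⟶ L)
    (g : power Y ⟶ powFrame L X.obj) :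
    evalHom X Y ≫ liftHom (h ≫ constHom L X.obj) (.ofHom (diagHom L X)) = g ↔
      h = (FunctionalRelation.ofPartition (.ofHom g)).hom := by
  let ψ := liftHom (h ≫ constHom L X.obj) (.ofHom (diagHom L X))
  have app_ap_comp : ∀ ⦃U V : C⦄ (y : Y.obj.obj (op U)) (f : V ⟶ U) (x : X.obj.obj (op V)),
      PowSection.app (IFrame.ap (evalHom X Y ≫ ψ) (point Y y)) f x =
        IFrame.ap h (U := V) (GraphOpen.gen J x (Y.obj.map f.op y)) := fun U V y f x =>
    (congrArg (fun s => PowSection.app (IFrame.ap ψ s) f x) (ap_evalHom_point y)).trans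
      (app_powAp_liftHom h ((FunctionalRelation.generic J X.obj Y.obj).partition.sec y) f x)
  constructor
  · rintro rfl
    refine GraphOpen.hom_ext fun U x y => ?_
    rw [FunctionalRelation.ap_hom_gen]
    refine Eq.trans ?_ (app_ap_comp y (𝟙 U) x).symm
    rw [op_id, Functor.map_id_apply]
  · rintro rfl
    refine power_hom_ext fun U y => PowSection.ext_app (L := L) (X := X.obj) fun V f x => ?_
    rw [app_ap_comp, FunctionalRelation.ap_hom_gen]
    exact (congrArg (PowSection.app · (𝟙 V) x) ((IPartition.ofHom g).sec_map f y)).trans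
      (PowSection.pull_app_id f _ x)

theorem isExponential_graphLocale (X Y : Sheaf J (Type u)) :
    IsExponential (prodFan (graphLocale X Y) X) (prodFanIsLimit (graphLocale X Y) X)
      (evalMap X Y) :=
  .of_isLimit (prodFan · X) (prodFanIsLimit · X) (evalMap X Y) fun Z g => by
    have lift_eq_iff : ∀ h : Z ⟶ graphLocale X Y,
        (prodFanIsLimit _ X).lift (BinaryFan.mk ((prodFan Z X).fst ≫ h) (prodFan Z X).snd) ≫
          evalMap X Y = g ↔ h.unop = (FunctionalRelation.ofPartition (.ofHom g.unop)).hom :=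
      fun h => Iff.trans ⟨congrArg Quiver.Hom.unop, congrArg Quiver.Hom.op⟩
        (evalHom_comp_liftHom_eq_iff h.unop g.unop)
    exact ⟨Quiver.Hom.op (FunctionalRelation.ofPartition (.ofHom g.unop)).hom,
      (lift_eq_iff _).2 rfl, fun h e => congrArg Quiver.Hom.op ((lift_eq_iff h).1 e)⟩

theorem preim_fst_gen_inf_preim_snd (x : X.obj.obj (op U)) (y : Y.obj.obj (op U)) :
    preim (prodFan (graphLocale X Y) X).fst (U := U) (GraphOpen.gen J x y) ⊓
        preim (prodFan (graphLocale X Y) X).snd (point X x) =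
      preim (evalMap X Y) (point Y y) ⊓ preim (prodFan (graphLocale X Y) X).snd (point X x) := by
  let R := FunctionalRelation.generic J X.obj Y.obj
  have preim_snd : preim (prodFan (graphLocale X Y) X).snd (point X x) = diagSection _ x :=
    ap_diagHom_point x
  have preim_ev : preim (evalMap X Y) (point Y y) = R.partition.sec y := ap_evalHom_point y
  have := diagSection_inf_constSection x (R.partition.sec y)
  rw [R.partition_sec_app, op_id, Functor.map_id_apply, inf_comm,
    inf_comm (diagSection _ x)] at this
  rw [preim_snd, preim_ev]
  exact this.symm

end Exponential

section Ideals

namespace IBool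

variable (A : IBool J) {U V : C}

theorem map_mono (f : V ⟶ U) {a b : A.obj.obj (op U)} (h : a ≤ b) :
    A.obj.map f.op a ≤ A.obj.map f.op b :=
  OrderHomClass.mono (A.obj.map f.op).hom h

theorem ext_of_cover {R : Sieve U} (hR : R ∈ J U) {a b : A.obj.obj (op U)}
    (h : ∀ ⦃V : C⦄ (f : V ⟶ U), R f → A.obj.map f.op a = A.obj.map f.op b) : a = b :=
  (A.isSheaf R hR).isSeparatedFor.ext h

theorem le_of_cover {R : Sieve U} (hR : R ∈ J U) {a b : A.obj.obj (op U)}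
    (h : ∀ ⦃V : C⦄ (f : V ⟶ U), R f → A.obj.map f.op a ≤ A.obj.map f.op b) : a ≤ b :=
  inf_eq_left.1 <| A.ext_of_cover hR fun V f hf => by
    rw [map_inf, inf_eq_left]
    exact h f hf

end IBool

namespace Idl

variable {A : IBool J} {U V W : C}

/-- Membership of `a` in an internal ideal, at the later stage `f : V ⟶ U`. -/
def Mem (I : Idl A U) (f : V ⟶ U) (a : A.obj.obj (op V)) : Prop := a ∈ I.1.carrier f

variable (I : Idl A U) {f : V ⟶ U} {a b : A.obj.obj (op V)}

theorem mem_restrict (h : I.Mem f a) (g : W ⟶ V) : I.Mem (g ≫ f) (A.obj.map g.op a) :=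
  I.1.restrict f a h g

theorem mem_local {R : Sieve V} (hR : R ∈ J V)
    (h : ∀ ⦃W : C⦄ (g : W ⟶ V), R g → I.Mem (g ≫ f) (A.obj.map g.op a)) : I.Mem f a :=
  I.1.isLocal f a R hR h

theorem mem_bot : I.Mem f ⊥ := (I.2 f).1

theorem mem_of_le (h : a ≤ b) (hb : I.Mem f b) : I.Mem f a := (I.2 f).2.1 a b h hb

theorem mem_sup (ha : I.Mem f a) (hb : I.Mem f b) : I.Mem f (a ⊔ b) := (I.2 f).2.2 a b ha hb

theorem mem_finset_sup {α : Type*} (s : Finset α) {F : α → A.obj.obj (op V)}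
    (h : ∀ x ∈ s, I.Mem f (F x)) : I.Mem f (s.sup F) :=
  Finset.sup_induction I.mem_bot (fun _ ha _ hb => I.mem_sup ha hb) h

theorem mem_pull_id : (I.pull f).Mem (𝟙 V) a ↔ I.Mem f a := by
  change I.Mem (𝟙 V ≫ f) a ↔ _
  rw [Category.id_comp]

variable {I} in
theorem le_of_mem_top (h : I.Mem (𝟙 U) ⊤) (I' : Idl A U) : I' ≤ I :=
  fun V f (a : A.obj.obj (op V)) _ => by
    refine I.mem_of_le (le_top : a ≤ ⊤) ?_
    simpa using I.mem_restrict h f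

/-- The ideal of elements which locally belong to a family of ideals of sections. -/
def ofLocal (S : SubFamily (A.obj ⋙ forget BoolAlg) U)
    (bot : ∀ ⦃V : C⦄ (f : V ⟶ U), (⊥ : A.obj.obj (op V)) ∈ S.carrier f)
    (of_le : ∀ ⦃V : C⦄ (f : V ⟶ U) (a b : A.obj.obj (op V)),
      a ≤ b → b ∈ S.carrier f → a ∈ S.carrier f)
    (sup : ∀ ⦃V : C⦄ (f : V ⟶ U) (a b : A.obj.obj (op V)),
      a ∈ S.carrier f → b ∈ S.carrier f → a ⊔ b ∈ S.carrier f) : Idl A U :=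
  ⟨LocalFamily.closure S, fun V f => by
    refine ⟨LocalFamily.subset_closure (bot f), ?_, ?_⟩
    · rintro a b hab ⟨R, hR, h⟩
      exact ⟨R, hR, fun W g hg => of_le _ _ _ (A.map_mono g hab) (h g hg)⟩
    · rintro a b ⟨R, hR, h⟩ ⟨R', hR', h'⟩
      refine ⟨R ⊓ R', J.intersection_covering hR hR', fun W g hg => ?_⟩
      change A.obj.map g.op (a ⊔ b) ∈ _
      rw [map_sup]
      exact sup _ _ _ (h g hg.1) (h' g hg.2)⟩

/-- The principal ideal of `a`. -/
def principal (a : A.obj.obj (op U)) : Idl A U :=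
  ⟨{ carrier := fun V f => {b : A.obj.obj (op V) | b ≤ A.obj.map f.op a}
     restrict := fun V f (b : A.obj.obj (op V)) (h : b ≤ A.obj.map f.op a) W g => by
      change A.obj.map g.op b ≤ A.obj.map (g ≫ f).op a
      rw [← map_map]
      exact A.map_mono g h
     isLocal := fun V f (b : A.obj.obj (op V)) R hR h => A.le_of_cover hR fun W g hg => by
      rw [map_map]
      exact h g hg },
    fun V _ => ⟨bot_le (α := A.obj.obj (op V)), fun _ _ => le_trans,
      fun _ _ => sup_le (α := A.obj.obj (op V))⟩⟩

theorem mem_principal {a : A.obj.obj (op U)} {f : V ⟶ U} {b : A.obj.obj (op V)} :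
    (principal a).Mem f b ↔ b ≤ A.obj.map f.op a := Iff.rfl

theorem principal_le_iff {a : A.obj.obj (op U)} {I : Idl A U} :
    principal a ≤ I ↔ I.Mem (𝟙 U) a := by
  constructor
  · exact fun h => h (𝟙 U) a (mem_principal.2 (by simp))
  · intro h V f (b : A.obj.obj (op V)) hb
    refine I.mem_of_le (mem_principal.1 hb) ?_
    simpa using I.mem_restrict h f

end Idl

end Ideals

section Clopens

variable {Z : ILocale J} {U : C}

theorem isComplemented_of_cover {R : Sieve U} (hR : R ∈ J U) {s : (opens Z).obj (op U)}
    (h : ∀ ⦃V : C⦄ (f : V ⟶ U), R f → IsComplemented ((opens Z).map f.op s)) :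
    IsComplemented s := by
  let restrictions : Presieve.FamilyOfElements ((Clop Z).obj ⋙ forget BoolAlg) R.arrows :=
    fun V f hf => show Complementeds ((opens Z).obj (op V)) from ⟨(opens Z).map f.op s, h f hf⟩
  have compatible : restrictions.Compatible := by
    rw [Presieve.compatible_iff_sieveCompatible]
    exact fun V W f g hf => Subtype.ext (map_map (opens Z) f g s).symm
  obtain ⟨(c : Complementeds ((opens Z).obj (op U))), hc, -⟩ :=
    (Clop Z).isSheaf R hR restrictions compatible
  have c_eq : c.1 = s := Z.unop.ext_of_cover hR fun V f hf => congrArg Subtype.val (hc f hf)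
  exact c_eq ▸ c.2

end Clopens

section Stone

/-- An isomorphism between the opens of `Z` and the ideals of `A`, exhibiting `Z` as the spectrum
of `A`. -/
structure StoneIso (Z : ILocale J) (A : IBool J) where
  /-- The isomorphism on sections. -/
  iso : ∀ U : C, (opens Z).obj (op U) ≃o Idl A U
  nat : ∀ ⦃U V : C⦄ (h : V ⟶ U) (a : (opens Z).obj (op U)),
    iso V ((opens Z).map h.op a) = (iso U a).pull h

namespace StoneIso

variable {Z : ILocale J} {A : IBool J} (e : StoneIso Z A) {U V : C}

/-- The clopen of `Z` corresponding to an element of `A`. -/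
def basic (a : A.obj.obj (op U)) : (opens Z).obj (op U) := (e.iso U).symm (Idl.principal a)

theorem basic_le_iff {a : A.obj.obj (op U)} {s : (opens Z).obj (op U)} :
    e.basic a ≤ s ↔ (e.iso U s).Mem (𝟙 U) a := by
  rw [basic, OrderIso.symm_apply_le, Idl.principal_le_iff]

theorem basic_le_map_iff {f : V ⟶ U} {a : A.obj.obj (op V)} {s : (opens Z).obj (op U)} :
    e.basic a ≤ (opens Z).map f.op s ↔ (e.iso U s).Mem f a := by
  rw [basic_le_iff, e.nat, Idl.mem_pull_id]

theorem le_basic_iff {a : A.obj.obj (op U)} {s : (opens Z).obj (op U)} :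
    s ≤ e.basic a ↔ ∀ ⦃V : C⦄ (f : V ⟶ U) (b : A.obj.obj (op V)),
      (e.iso U s).Mem f b → b ≤ A.obj.map f.op a := by
  rw [basic, OrderIso.le_symm_apply]
  rfl

theorem top_le_iff {s : (opens Z).obj (op U)} : ⊤ ≤ s ↔ (e.iso U s).Mem (𝟙 U) ⊤ :=
  ⟨fun h => e.basic_le_iff.1 (le_top.trans h),
    fun h => (e.iso U).le_iff_le.1 (Idl.le_of_mem_top h _)⟩

theorem isCompl_basic (a : A.obj.obj (op U)) : IsCompl (e.basic a) (e.basic aᶜ) := by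
  refine .of_le ?_ ?_
  · refine (e.iso U).le_iff_le.1 fun V f (b : A.obj.obj (op V)) hb => ?_
    have b_le : b ≤ A.obj.map f.op a := e.le_basic_iff.1 inf_le_left f b hb
    have b_le_compl : b ≤ A.obj.map f.op aᶜ := e.le_basic_iff.1 inf_le_right f b hb
    refine (e.iso U ⊥).mem_of_le ((le_inf b_le b_le_compl).trans_eq ?_) (e.iso U ⊥).mem_bot
    rw [← map_inf, inf_compl_self, map_bot]
  · rw [e.top_le_iff, ← sup_compl_eq_top (x := a)]
    exact Idl.mem_sup _
      (e.basic_le_iff.1 le_sup_left) (e.basic_le_iff.1 le_sup_right)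

end StoneIso

namespace IsStone

variable {Z : ILocale J} {U : C}

theorem le_of_forall_isComplemented (hZ : IsStone Z) {s t : (opens Z).obj (op U)}
    (h : ∀ ⦃V : C⦄ (f : V ⟶ U) (c : (opens Z).obj (op V)), IsComplemented c →
      c ≤ (opens Z).map f.op s → c ≤ (opens Z).map f.op t) : s ≤ t := by
  obtain ⟨A, iso, nat⟩ := hZ
  let e : StoneIso Z A := ⟨iso, nat⟩
  refine (iso U).le_iff_le.1 fun V f a ha => ?_
  exact e.basic_le_map_iff.1
    (h f (e.basic a) ⟨_, e.isCompl_basic a⟩ (e.basic_le_map_iff.2 ha))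

/-- A Stone space is compact. -/
theorem exists_cover_top_mem (hZ : IsStone Z) (Φ : SubFamily (opens Z ⋙ forget Frm) U)
    (nonempty : ∀ ⦃V : C⦄ (f : V ⟶ U), (Φ.carrier f).Nonempty)
    (directed : ∀ ⦃V : C⦄ (f : V ⟶ U) (a b : (opens Z).obj (op V)), a ∈ Φ.carrier f →
      b ∈ Φ.carrier f → ∃ c : (opens Z).obj (op V), c ∈ Φ.carrier f ∧ a ≤ c ∧ b ≤ c)
    (total : ∀ t : (opens Z).obj (op U), (∀ ⦃V : C⦄ (f : V ⟶ U) (a : (opens Z).obj (op V)),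
      a ∈ Φ.carrier f → a ≤ (opens Z).map f.op t) → ⊤ ≤ t) :
    ∃ R ∈ J U, ∀ ⦃V : C⦄ (f : V ⟶ U), R f → (⊤ : (opens Z).obj (op V)) ∈ Φ.carrier f := by
  obtain ⟨A, iso, nat⟩ := hZ
  let e : StoneIso Z A := ⟨iso, nat⟩
  have basic_mono : ∀ ⦃V : C⦄ {a b : A.obj.obj (op V)}, a ≤ b → e.basic a ≤ e.basic b :=
    fun V a b h => e.basic_le_iff.2 (Idl.mem_of_le _ h (e.basic_le_iff.1 le_rfl))
  let I : Idl A U := .ofLocal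
    { carrier := fun V f => {a | ∃ s : (opens Z).obj (op V), s ∈ Φ.carrier f ∧ e.basic a ≤ s}
      restrict := by
        rintro V f a ⟨s, hs, h⟩ W g
        refine ⟨_, Φ.restrict f s hs g, ?_⟩
        refine e.basic_le_map_iff.2 ?_
        simpa using Idl.mem_restrict _ (e.basic_le_iff.1 h) g }
    (fun V f => (nonempty f).imp fun s hs => ⟨hs, e.basic_le_iff.2 (Idl.mem_bot _)⟩)
    (fun V f a b h ⟨s, hs, hb⟩ => ⟨s, hs, (basic_mono h).trans hb⟩)
    (fun V f a b ⟨s, hs, ha⟩ ⟨t, ht, hb⟩ => (directed f s t hs ht).imp fun c hc =>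
      ⟨hc.1, e.basic_le_iff.2 (Idl.mem_sup _
        (e.basic_le_iff.1 (ha.trans hc.2.1)) (e.basic_le_iff.1 (hb.trans hc.2.2)))⟩)
  have top_mem : I.Mem (𝟙 U) ⊤ := by
    rw [← (iso U).apply_symm_apply I]
    refine e.top_le_iff.1 (total _ fun V f s hs => ?_)
    refine (iso V).le_iff_le.1 fun W g a ha => ?_
    rw [nat, (iso U).apply_symm_apply]
    exact LocalFamily.subset_closure ⟨_, Φ.restrict f s hs g, e.basic_le_map_iff.2 ha⟩
  obtain ⟨R, hR, h⟩ := top_mem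
  refine ⟨R, hR, fun V f hf => ?_⟩
  obtain ⟨s, hs, top_le⟩ := h f hf
  replace top_le : e.basic (A.obj.map f.op ⊤) ≤ s := top_le
  rw [map_top] at top_le
  rw [Category.comp_id] at hs
  exact top_le_iff.1 (e.top_le_iff.2 (e.basic_le_iff.1 top_le)) ▸ hs

end IsStone

/-- `Y` is decidable and finite in the internal logic. Decidability is expressed by the
complementedness of singletons, finiteness by the local existence of a finite set of sections
which generates `Y`. -/
structure IsDecidableFinite (Y : Sheaf J (Type u)) : Prop where
  isComplemented_point : ∀ ⦃U : C⦄ (y : Y.obj.obj (op U)), IsComplemented (point Y y)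
  exists_finset : ∀ U : C, ∃ R ∈ J U, ∀ ⦃V : C⦄ (f : V ⟶ U), R f →
    ∃ s : Finset (Y.obj.obj (op V)), s.sup (point Y) = ⊤

variable {Y : Sheaf J (Type u)} {U : C}

theorem IsStone.isComplemented_point (hY : IsStone (discrete Y)) (y : Y.obj.obj (op U)) :
    IsComplemented (point Y y) := by
  let Φ : SubFamily (powerFrm J Y.obj ⋙ forget Frm) U :=
    { carrier := fun V f => {c : (opens (discrete Y)).obj (op V) |
        IsComplemented c ∧ c ≤ point Y (Y.obj.map f.op y)}
      restrict := fun V f c hc W g => by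
        obtain ⟨⟨d, hd⟩, hc⟩ := hc
        refine ⟨⟨_, hd.map ((opens (discrete Y)).map g.op).hom⟩, ?_⟩
        rw [← map_map, ← map_point]
        exact map_mono (powerFrm J Y.obj) g hc }
  have point_le : pt y ≤ LocalFamily.closure (unionFamily Y.obj Φ) :=
    hY.le_of_forall_isComplemented fun V f c hc c_le =>
      (isJoin_unionFamily Y.obj Φ).le (f := f) (a := c) ⟨hc, c_le.trans_eq (map_point f y)⟩
  obtain ⟨R, hR, h⟩ := pt_le_iff.1 point_le
  refine isComplemented_of_cover hR fun V f hf => ?_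
  obtain ⟨c, ⟨hc, c_le⟩, y_mem⟩ := h f hf
  rw [Category.comp_id] at c_le
  have : c = point Y (Y.obj.map f.op y) := le_antisymm c_le (pt_le_iff.2 y_mem)
  exact (map_point f y).symm ▸ this ▸ hc

theorem isDecidableFinite_of_isStone (hY : IsStone (discrete Y)) : IsDecidableFinite Y := by
  classical
  refine ⟨fun U => hY.isComplemented_point, fun U => ?_⟩
  let finiteFamily : SubFamily (opens (discrete Y) ⋙ forget Frm) U :=
    { carrier := fun V _ => {t | ∃ s : Finset (Y.obj.obj (op V)), s.sup (point Y) = t}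
      restrict := by
        rintro V _ _ ⟨s, rfl⟩ W g
        refine ⟨s.image (Y.obj.map g.op), ?_⟩
        refine Eq.trans ?_ (map_finset_sup ((opens (discrete Y)).map g.op).hom s _).symm
        rw [Finset.sup_image]
        exact Finset.sup_congr rfl fun y _ => (map_point g y).symm }
  refine hY.exists_cover_top_mem finiteFamily (fun V f => ⟨_, ∅, rfl⟩) ?_ ?_
  · rintro V f _ _ ⟨s, rfl⟩ ⟨t, rfl⟩
    exact ⟨_, ⟨s ∪ t, rfl⟩, Finset.sup_mono Finset.subset_union_left,
      Finset.sup_mono Finset.subset_union_right⟩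
  · intro (t : LocalFamily J Y.obj U) h V f y _
    exact (mem_pull_id t f).1 (pt_le_iff.1 (h f (point Y y) ⟨{y}, Finset.sup_singleton⟩))

theorem LocalFamily.mem_sup {P : Cᵒᵖ ⥤ Type u} {V : C} {S T : LocalFamily J P U} {f : V ⟶ U}
    {x : P.obj (op V)} (h : x ∈ (S ⊔ T).carrier f) : ∃ R ∈ J V, ∀ ⦃W : C⦄ (g : W ⟶ V), R g →
      P.map g.op x ∈ S.carrier (g ≫ f) ∨ P.map g.op x ∈ T.carrier (g ≫ f) := by
  obtain ⟨R, hR, h⟩ := h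
  refine ⟨R, hR, fun W g hg => ?_⟩
  obtain ⟨Q, rfl | rfl, hQ⟩ := h g hg
  · exact .inl hQ
  · exact .inr hQ

theorem LocalFamily.bot_mem_of_mem_bot {P : Cᵒᵖ ⥤ Type u} {V : C} {f : V ⟶ U}
    {x : P.obj (op V)} (h : x ∈ (⊥ : LocalFamily J P U).carrier f) : ⊥ ∈ J V := by
  obtain ⟨R, hR, h⟩ := h
  have R_eq : R = ⊥ := le_bot_iff.1 fun W g hg => (h g hg).elim
  exact R_eq ▸ hR

theorem IsDecidableFinite.eq_or_apart (hY : IsDecidableFinite Y) (y y' : Y.obj.obj (op U)) :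
    ∃ R ∈ J U, ∀ ⦃V : C⦄ (f : V ⟶ U), R f → Y.obj.map f.op y = Y.obj.map f.op y' ∨
      ∀ ⦃W : C⦄ (g : W ⟶ V), Y.obj.map g.op (Y.obj.map f.op y) =
        Y.obj.map g.op (Y.obj.map f.op y') → ⊥ ∈ J W := by
  obtain ⟨(c : LocalFamily J Y.obj U), hc⟩ := hY.isComplemented_point y
  have mem_sup : y' ∈ (pt y ⊔ c).carrier (𝟙 U) := hc.codisjoint.top_le _ _ trivial
  obtain ⟨R, hR, h⟩ := LocalFamily.mem_sup mem_sup
  refine ⟨R, hR, fun V f hf => (h f hf).imp (fun hy => ?_) fun hy W g e => ?_⟩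
  · rw [Category.comp_id, mem_pt] at hy
    exact hy.symm
  · refine LocalFamily.bot_mem_of_mem_bot (hc.disjoint.le_bot (g ≫ f ≫ 𝟙 U) _
      ⟨?_, c.restrict _ _ hy g⟩)
    change _ ∈ (pt y).carrier _
    rw [mem_pt, Category.comp_id, ← map_map]
    exact e.symm

end Stone

noncomputable section BooleanPresentation

variable {X Y : Sheaf J (Type u)} {A : IBool J} {U V : C}

namespace Generators

variable (δ : Generators X Y A)

theorem elt_map (f : V ⟶ U) (x : X.obj.obj (op U)) (y : Y.obj.obj (op U)) :
    δ.elt (X.obj.map f.op x) (Y.obj.map f.op y) = A.obj.map f.op (δ.elt x y) :=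
  ConcreteCategory.congr_hom (δ.naturality f.op) ((x, y) : X.obj.obj (op U) × Y.obj.obj (op U))

/-- The meet of the generators in a word. -/
def word (l : Word X.obj Y.obj U) : A.obj.obj (op U) := l.inf fun p => δ.elt p.1 p.2

theorem map_word (f : V ⟶ U) (l : Word X.obj Y.obj U) :
    A.obj.map f.op (δ.word l) = δ.word (res f l) := by
  rw [word, word, res, Finset.inf_image]
  refine (map_finset_inf (A.obj.map f.op).hom l _).trans (Finset.inf_congr rfl fun p _ => ?_)
  exact (δ.elt_map f p.1 p.2).symm

theorem word_singleton (x : X.obj.obj (op U)) (y : Y.obj.obj (op U)) :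
    δ.word {(x, y)} = δ.elt x y := Finset.inf_singleton

variable {δ}

theorem sup_elt_eq_top (hδ : SatisfiesRelations δ) (x : X.obj.obj (op U))
    {s : Finset (Y.obj.obj (op U))} (hs : s.sup (point Y) = ⊤) : s.sup (δ.elt x) = ⊤ := by
  let bounded : LocalFamily J Y.obj U :=
    { carrier := fun V f => {y | δ.elt (X.obj.map f.op x) y ≤ A.obj.map f.op (s.sup (δ.elt x))}
      restrict := fun V f y h W g => by
        change δ.elt (X.obj.map (g ≫ f).op x) (Y.obj.map g.op y) ≤ _
        rw [← map_map, ← map_map, δ.elt_map]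
        exact A.map_mono g h
      isLocal := fun V f y R hR h => A.le_of_cover hR fun W g hg => by
        rw [← δ.elt_map, map_map, map_map]
        exact h g hg }
  have point_le : ∀ y ∈ s, point Y y ≤ bounded := fun y hy => pt_le_iff.2 <| by
    change δ.elt (X.obj.map (𝟙 U).op x) y ≤ A.obj.map (𝟙 U).op (s.sup (δ.elt x))
    rw [op_id, Functor.map_id_apply, Functor.map_id_apply]
    exact Finset.le_sup hy
  have top_le : (⊤ : LocalFamily J Y.obj U) ≤ bounded := hs.ge.trans (Finset.sup_le point_le)
  exact top_le_iff.1 (hδ.total x _ fun V f y => top_le f y trivial)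

variable (hY : IsDecidableFinite Y) (hδ : SatisfiesRelations δ)

/-- The open of words whose value lies in `I`: the right adjoint of the map from opens to ideals of
`A` induced by `δ`. -/
def pre (I : Idl A U) : GraphOpen J X.obj Y.obj U where
  Mem _ f l := I.Mem f (δ.word l)
  restrict _ f l h _ g := by
    rw [← δ.map_word]
    exact I.mem_restrict h g
  isLocal _ f l R hR h := I.mem_local hR fun W g hg => by
    rw [δ.map_word]
    exact h g hg
  mono _ _ _ _ hl h := I.mem_of_le (Finset.inf_mono hl) h
  total V f l x h := by
    obtain ⟨R, hR, finite⟩ := hY.exists_finset V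
    refine I.mem_local hR fun W g hg => ?_
    obtain ⟨s, hs⟩ := finite g hg
    have word_eq : A.obj.map g.op (δ.word l) =
        s.sup fun y => δ.word (insert (X.obj.map g.op x, y) (res g l)) := by
      simp only [word, Finset.inf_insert, ← Finset.sup_inf_distrib_right]
      rw [sup_elt_eq_top hδ _ hs, top_inf_eq]
      exact δ.map_word g l
    rw [word_eq]
    exact I.mem_finset_sup s fun y _ => h g y
  single V f l x y y' hy hy' h := by
    obtain ⟨R, hR, eq_or_apart⟩ := hY.eq_or_apart y y'
    refine I.mem_local hR fun W g hg => ?_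
    rcases eq_or_apart g hg with e | apart
    · rw [δ.map_word]
      exact h g e
    · have word_le : δ.word (res g l) ≤ ⊥ :=
        (le_inf (Finset.inf_le (mem_res g hy)) (Finset.inf_le (mem_res g hy'))).trans
          (hδ.single (X.obj.map g.op x) _ _ apart)
      rw [δ.map_word]
      exact I.mem_of_le word_le I.mem_bot

theorem mem_top_of_top_le_pre {I : Idl A U} (h : ⊤ ≤ pre hY hδ I) : I.Mem (𝟙 U) ⊤ :=
  h (𝟙 U) ∅ fun _ h => h.elim

/-- The open of words whose value lies below `a`. -/
def below (a : A.obj.obj (op U)) : GraphOpen J X.obj Y.obj U := pre hY hδ (Idl.principal a)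

variable {hY hδ}

theorem mem_below {a : A.obj.obj (op U)} {f : V ⟶ U} {l : Word X.obj Y.obj V} :
    (below hY hδ a).Mem f l ↔ δ.word l ≤ A.obj.map f.op a := Iff.rfl

theorem pull_below (f : V ⟶ U) (a : A.obj.obj (op U)) :
    (below hY hδ a).pull f = below hY hδ (A.obj.map f.op a) :=
  GraphOpen.ext_mem fun W g l => by
    rw [GraphOpen.mem_pull, mem_below, mem_below, map_map]

theorem below_mono : Monotone (below hY hδ (U := U)) :=
  fun _ _ h _ f _ hl => le_trans (mem_below.1 hl) (A.map_mono f h)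

theorem below_inf (a b : A.obj.obj (op U)) :
    below hY hδ (a ⊓ b) = below hY hδ a ⊓ below hY hδ b :=
  GraphOpen.ext_mem fun W g l => by
    rw [mem_below, map_inf, le_inf_iff]
    rfl

theorem below_top : below hY hδ (⊤ : A.obj.obj (op U)) = ⊤ :=
  top_le_iff.1 fun V f l _ => mem_below.2 <| by
    rw [map_top]
    exact le_top

theorem top_le_of_top_le_below {a : A.obj.obj (op U)} (h : ⊤ ≤ below hY hδ a) : ⊤ ≤ a := by
  simpa only [Idl.mem_principal, op_id, Functor.map_id_apply] using mem_top_of_top_le_pre hY hδ h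

theorem le_below_compl_word {I K : GraphOpen J X.obj Y.obj U} (h : Disjoint I K)
    {l : Word X.obj Y.obj U} (hl : I.Mem (𝟙 U) l) : K ≤ below hY hδ (δ.word l)ᶜ := by
  intro V f m hm
  have mem_bot : (⊥ : GraphOpen J X.obj Y.obj U).Mem f (m ∪ res f l) :=
    h.le_bot f _ ⟨I.mono Finset.subset_union_right (by simpa using I.restrict hl f),
      K.mono Finset.subset_union_left hm⟩
  have word_le : δ.word (m ∪ res f l) ≤ A.obj.map f.op ⊥ :=
    mem_below.1 ((bot_le : ⊥ ≤ below hY hδ ⊥) f _ mem_bot)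
  rw [map_bot, word, Finset.inf_union] at word_le
  rw [mem_below, map_compl', le_compl_iff_disjoint_right, disjoint_iff_inf_le, δ.map_word]
  exact word_le

end Generators

end BooleanPresentation

noncomputable section ClopenRepresentation

variable {X Y : Sheaf J (Type u)} {U V : C}

/-- The open of `Y ^ X` underlying a clopen. -/
def toGraphOpen (c : (Clop (graphLocale X Y)).obj.obj (op U)) : GraphOpen J X.obj Y.obj U :=
  Clop.toOpen c

theorem toGraphOpen_le_iff {c d : (Clop (graphLocale X Y)).obj.obj (op U)} :
    toGraphOpen c ≤ toGraphOpen d ↔ c ≤ d := Iff.rfl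

theorem toGraphOpen_map (f : V ⟶ U) (c : (Clop (graphLocale X Y)).obj.obj (op U)) :
    toGraphOpen ((Clop (graphLocale X Y)).obj.map f.op c) = (toGraphOpen c).pull f := rfl

theorem isCompl_toGraphOpen (c : (Clop (graphLocale X Y)).obj.obj (op U)) :
    IsCompl (toGraphOpen c) (toGraphOpen cᶜ) :=
  Complementeds.isCompl_coe.2 (isCompl_compl (x := c))

variable {A : IBool J} {δ : Generators X Y A} {hY : IsDecidableFinite Y}
  {hδ : SatisfiesRelations δ} {c d : (Clop (graphLocale X Y)).obj.obj (op U)}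
  {a a' b b' : A.obj.obj (op U)}

open Generators

variable (hY hδ) in
/-- `a` is the value at `c` of the homomorphism which extends `δ`. -/
structure Represents (c : (Clop (graphLocale X Y)).obj.obj (op U)) (a : A.obj.obj (op U)) :
    Prop where
  le : toGraphOpen c ≤ below hY hδ a
  compl_le : toGraphOpen cᶜ ≤ below hY hδ aᶜ

namespace Represents

theorem value_le (h : Represents hY hδ c a) (h' : Represents hY hδ c a') : a ≤ a' := by
  have top_le : ⊤ ≤ below hY hδ (a ⇨ a') := by
    rw [← (isCompl_toGraphOpen c).sup_eq_top]
    exact sup_le (h'.le.trans (below_mono le_himp)) (h.compl_le.trans (below_mono compl_le_himp))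
  exact himp_eq_top_iff.1 (top_le_iff.1 (top_le_of_top_le_below top_le))

theorem unique (h : Represents hY hδ c a) (h' : Represents hY hδ c a') : a = a' :=
  le_antisymm (h.value_le h') (h'.value_le h)

theorem pull (h : Represents hY hδ c a) (f : V ⟶ U) :
    Represents hY hδ ((Clop (graphLocale X Y)).obj.map f.op c) (A.obj.map f.op a) where
  le := by
    rw [toGraphOpen_map, ← pull_below]
    exact fun W g => h.le (g ≫ f)
  compl_le := by
    rw [← map_compl', ← map_compl', toGraphOpen_map, ← pull_below]
    exact fun W g => h.compl_le (g ≫ f)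

theorem compl (h : Represents hY hδ c a) : Represents hY hδ cᶜ aᶜ where
  le := h.compl_le
  compl_le := by
    rw [compl_compl, compl_compl]
    exact h.le

theorem inf (h : Represents hY hδ c a) (h' : Represents hY hδ d a') :
    Represents hY hδ (c ⊓ d) (a ⊓ a') where
  le := by
    rw [below_inf]
    exact inf_le_inf h.le h'.le
  compl_le := by
    rw [compl_inf, compl_inf]
    exact sup_le (h.compl_le.trans (below_mono le_sup_left))
      (h'.compl_le.trans (below_mono le_sup_right))

theorem sup (h : Represents hY hδ c a) (h' : Represents hY hδ d a') :
    Represents hY hδ (c ⊔ d) (a ⊔ a') := by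
  simpa only [compl_inf, compl_compl] using (h.compl.inf h'.compl).compl

theorem top : Represents hY hδ (⊤ : (Clop (graphLocale X Y)).obj.obj (op U)) ⊤ where
  le := le_top.trans_eq below_top.symm
  compl_le := by
    rw [compl_top]
    exact (bot_le : (⊥ : GraphOpen J X.obj Y.obj U) ≤ _)

theorem bot : Represents hY hδ (⊥ : (Clop (graphLocale X Y)).obj.obj (op U)) ⊥ := by
  simpa only [compl_top] using (top (hY := hY) (hδ := hδ) (U := U)).compl

theorem of_cover {R : Sieve U} (hR : R ∈ J U) (h : ∀ ⦃V : C⦄ (f : V ⟶ U), R f →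
    Represents hY hδ ((Clop (graphLocale X Y)).obj.map f.op c) (A.obj.map f.op a)) :
    Represents hY hδ c a where
  le := GraphOpen.le_of_cover hR fun V f hf => by
    rw [pull_below]
    exact (h f hf).le
  compl_le := GraphOpen.le_of_cover hR fun V f hf => by
    rw [pull_below, map_compl', ← toGraphOpen_map, map_compl']
    exact (h f hf).compl_le

end Represents

variable (hY hδ) in
/-- `a` and the value at `c` of the homomorphism which extends `δ` agree on `b`. -/
structure RepresentsOn (b : A.obj.obj (op U)) (c : (Clop (graphLocale X Y)).obj.obj (op U))
    (a : A.obj.obj (op U)) : Prop where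
  le : toGraphOpen c ≤ below hY hδ (b ⇨ a)
  compl_le : toGraphOpen cᶜ ≤ below hY hδ (b ⇨ aᶜ)

namespace RepresentsOn

theorem represents (h : RepresentsOn hY hδ ⊤ c a) : Represents hY hδ c a where
  le := by simpa only [top_himp] using h.le
  compl_le := by simpa only [top_himp] using h.compl_le

theorem pull (h : RepresentsOn hY hδ b c a) (f : V ⟶ U) :
    RepresentsOn hY hδ (A.obj.map f.op b) ((Clop (graphLocale X Y)).obj.map f.op c)
      (A.obj.map f.op a) where
  le := by
    rw [himp_eq, ← map_compl', ← map_sup, ← himp_eq, toGraphOpen_map, ← pull_below]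
    exact fun W g => h.le (g ≫ f)
  compl_le := by
    rw [himp_eq, ← map_compl', ← map_compl', ← map_compl', ← map_sup, ← himp_eq, toGraphOpen_map,
      ← pull_below]
    exact fun W g => h.compl_le (g ≫ f)

theorem mono (h : RepresentsOn hY hδ b c a) (hb : b' ≤ b) : RepresentsOn hY hδ b' c a where
  le := h.le.trans (below_mono (himp_le_himp_right hb))
  compl_le := h.compl_le.trans (below_mono (himp_le_himp_right hb))

theorem bot : RepresentsOn hY hδ ⊥ c a where
  le := by simp only [bot_himp, below_top, le_top]
  compl_le := by simp only [bot_himp, below_top, le_top]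

theorem sup (h : RepresentsOn hY hδ b c a) (h' : RepresentsOn hY hδ b' c a') :
    RepresentsOn hY hδ (b ⊔ b') c (a ⊓ b ⊔ a' ⊓ b') where
  le := by
    refine (le_inf h.le h'.le).trans ((below_inf _ _).ge.trans (below_mono ?_))
    rw [le_himp_iff, inf_sup_left]
    refine sup_le_sup (le_inf ?_ inf_le_right) (le_inf ?_ inf_le_right)
    · exact (inf_le_inf_right b inf_le_left).trans himp_inf_le
    · exact (inf_le_inf_right b' inf_le_right).trans himp_inf_le
  compl_le := by
    refine (le_inf h.compl_le h'.compl_le).trans ((below_inf _ _).ge.trans (below_mono ?_))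
    refine le_trans ?_ le_himp
    rw [compl_sup, compl_inf, compl_inf, himp_eq, himp_eq]

theorem of_mem {l : Word X.obj Y.obj U} (hl : (toGraphOpen c).Mem (𝟙 U) l) :
    RepresentsOn hY hδ (δ.word l) c ⊤ where
  le := by simp only [himp_top, below_top, le_top]
  compl_le := by
    rw [compl_top, himp_bot]
    exact le_below_compl_word (isCompl_toGraphOpen c).disjoint hl

theorem of_mem_compl {l : Word X.obj Y.obj U} (hl : (toGraphOpen cᶜ).Mem (𝟙 U) l) :
    RepresentsOn hY hδ (δ.word l) c ⊥ where
  le := by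
    rw [himp_bot]
    exact le_below_compl_word (isCompl_toGraphOpen c).disjoint.symm hl
  compl_le := by simp only [compl_bot, himp_top, below_top, le_top]

end RepresentsOn

variable (hY hδ c) in
/-- The ideal of elements on which the value at `c` of the homomorphism extending `δ` exists. -/
def representabilityIdeal : Idl A U :=
  .ofLocal
    { carrier := fun V f =>
        {b | ∃ a, RepresentsOn hY hδ b ((Clop (graphLocale X Y)).obj.map f.op c) a}
      restrict := by
        rintro V f b ⟨a, h⟩ W g
        exact ⟨_, map_map (Clop (graphLocale X Y)).obj f g c ▸ h.pull g⟩ }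
    (fun _ _ => ⟨⊥, .bot⟩)
    (fun _ _ _ _ hb ⟨a, h⟩ => ⟨a, h.mono hb⟩)
    (fun _ _ _ _ ⟨_, h⟩ ⟨_, h'⟩ => ⟨_, h.sup h'⟩)

theorem top_le_pre_representabilityIdeal : ⊤ ≤ pre hY hδ (representabilityIdeal hY hδ c) := by
  rw [← (isCompl_toGraphOpen c).sup_eq_top]
  refine sup_le (fun V f l hl => ?_) fun V f l hl => ?_
  · refine LocalFamily.subset_closure ⟨⊤, .of_mem ?_⟩
    rw [toGraphOpen_map]
    exact GraphOpen.mem_pull_id.2 hl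
  · refine LocalFamily.subset_closure ⟨⊥, .of_mem_compl ?_⟩
    rw [← map_compl', toGraphOpen_map]
    exact GraphOpen.mem_pull_id.2 hl

variable (hY hδ c) in
theorem exists_represents : ∃ a, Represents hY hδ c a := by
  obtain ⟨R, hR, h⟩ := mem_top_of_top_le_pre hY hδ (top_le_pre_representabilityIdeal (c := c))
  have locally_represented : ∀ ⦃V : C⦄ (f : V ⟶ U), R f →
      ∃ a, Represents hY hδ ((Clop (graphLocale X Y)).obj.map f.op c) a := fun V f hf => by
    obtain ⟨a, ha⟩ := h f hf
    replace ha : RepresentsOn hY hδ (A.obj.map f.op ⊤) _ a := ha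
    rw [map_top, Category.comp_id] at ha
    exact ⟨a, ha.represents⟩
  choose a ha using locally_represented
  let values : Presieve.FamilyOfElements (A.obj ⋙ forget BoolAlg) R.arrows := a
  have compatible : values.Compatible := by
    rw [Presieve.compatible_iff_sieveCompatible]
    intro V W f g hf
    refine (ha (g ≫ f) (R.downward_closed hf g)).unique ?_
    rw [← map_map]
    exact (ha f hf).pull g
  obtain ⟨b, hb, -⟩ := A.isSheaf R hR values compatible
  refine ⟨b, .of_cover hR fun V f hf => ?_⟩
  have map_b : A.obj.map f.op b = a f hf := hb f hf
  exact map_b ▸ ha f hf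

end ClopenRepresentation

noncomputable section ClopenPresentation

variable {X Y : Sheaf J (Type u)} {U V : C}

theorem isComplemented_gen (hY : IsDecidableFinite Y) (x : X.obj.obj (op U))
    (y : Y.obj.obj (op U)) : IsComplemented (GraphOpen.gen J x y) := by
  obtain ⟨z, hz⟩ := hY.isComplemented_point y
  have eval_point : PowSection.app (IFrame.ap (evalHom X Y) (point Y y)) (𝟙 U) x =
      GraphOpen.gen J x y := by
    rw [ap_evalHom_point, FunctionalRelation.partition_sec_app, op_id, Functor.map_id_apply]
    rfl
  have eval_compl : IsCompl (IFrame.ap (evalHom X Y) (point Y y)) (IFrame.ap (evalHom X Y) z) :=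
    IsCompl.map (α := (power Y).obj.obj (op U)) ((evalHom X Y).hom.app (op U)).hom hz
  rw [← eval_point]
  exact ⟨_, IsCompl.map (α := PowSection _ _ U) (PowSection.appHom (𝟙 U) x) eval_compl⟩

variable (X) in
/-- The clopens `(x, y) = {θ | θ x = y}` of `Y ^ X`. -/
def clopenGenerators (hY : IsDecidableFinite Y) : Generators X Y (Clop (graphLocale X Y)) where
  app U := ↾fun p : X.obj.obj U × Y.obj.obj U =>
    show Complementeds (GraphOpen J X.obj Y.obj U.unop) from
      ⟨GraphOpen.gen J p.1 p.2, isComplemented_gen hY p.1 p.2⟩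
  naturality U _ f := ConcreteCategory.hom_ext _ _ fun p : X.obj.obj U × Y.obj.obj U =>
    Subtype.ext (GraphOpen.pull_gen f.unop p.1 p.2).symm

variable (hY : IsDecidableFinite Y)

theorem satisfiesRelations_clopenGenerators : SatisfiesRelations (clopenGenerators X hY) where
  total _ x b h := (FunctionalRelation.generic J X.obj Y.obj).total x (toGraphOpen b) h
  single _ x y y' h := ((FunctionalRelation.generic J X.obj Y.obj).single x y y').trans <|
    IFrame.eqv_le_iff.2 fun _ f e =>
      IFrame.le_of_cover _ (h f e) fun _ _ hg => hg.elim

theorem toGraphOpen_word (l : Word X.obj Y.obj U) :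
    toGraphOpen ((clopenGenerators X hY).word l) = GraphOpen.principal J l := by
  rw [GraphOpen.principal_eq_inf_gen]
  exact Finset.apply_inf_eq_inf_comp toGraphOpen (fun _ _ => rfl) rfl

theorem word_le_map_iff {l : Word X.obj Y.obj V} {f : V ⟶ U}
    {c : (Clop (graphLocale X Y)).obj.obj (op U)} :
    (clopenGenerators X hY).word l ≤ (Clop (graphLocale X Y)).obj.map f.op c ↔
      (toGraphOpen c).Mem f l := by
  rw [← toGraphOpen_le_iff, toGraphOpen_word, GraphOpen.principal_le_iff, toGraphOpen_map,
    GraphOpen.mem_pull_id]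

/-- The ideal of clopens contained in the open `c` of `Y ^ X`. -/
def clopensBelow (c : GraphOpen J X.obj Y.obj U) : Idl (Clop (graphLocale X Y)) U :=
  ⟨{ carrier := fun V f => {d : (Clop (graphLocale X Y)).obj.obj (op V) | toGraphOpen d ≤ c.pull f}
     restrict := fun V f (d : (Clop (graphLocale X Y)).obj.obj (op V)) h W g => by
      change toGraphOpen ((Clop (graphLocale X Y)).obj.map g.op d) ≤ _
      rw [toGraphOpen_map, ← GraphOpen.pull_pull]
      exact fun W' k => h (k ≫ g)
     isLocal := fun V f (d : (Clop (graphLocale X Y)).obj.obj (op V)) R hR h =>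
      GraphOpen.le_of_cover hR fun W g hg => by
        rw [← toGraphOpen_map, GraphOpen.pull_pull]
        exact h g hg },
    fun _ _ => ⟨bot_le (α := GraphOpen J X.obj Y.obj _),
      fun _ _ => le_trans (α := GraphOpen J X.obj Y.obj _),
      fun _ _ => sup_le (α := GraphOpen J X.obj Y.obj _)⟩⟩

theorem mem_clopensBelow {c : GraphOpen J X.obj Y.obj U} {f : V ⟶ U}
    {d : (Clop (graphLocale X Y)).obj.obj (op V)} :
    (clopensBelow c).Mem f d ↔ toGraphOpen d ≤ c.pull f := Iff.rfl

theorem clopensBelow_mono : Monotone (clopensBelow (X := X) (Y := Y) (U := U)) :=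
  fun _ _ h _ f _ hd _ g l hl => h (g ≫ f) l (hd g l hl)

theorem clopensBelow_pull (c : GraphOpen J X.obj Y.obj U) (f : V ⟶ U) :
    clopensBelow (c.pull f) = (clopensBelow c).pull f :=
  Subtype.ext <| LocalFamily.ext_mem fun W g d => by
    change toGraphOpen d ≤ (c.pull f).pull g ↔ toGraphOpen d ≤ c.pull (g ≫ f)
    rw [GraphOpen.pull_pull]

open Generators

theorem pre_clopensBelow (c : GraphOpen J X.obj Y.obj U) :
    pre hY (satisfiesRelations_clopenGenerators hY) (clopensBelow c) = c :=
  GraphOpen.ext_mem fun V f l => by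
    change (clopensBelow c).Mem f ((clopenGenerators X hY).word l) ↔ _
    rw [mem_clopensBelow, toGraphOpen_word, GraphOpen.principal_le_iff, GraphOpen.mem_pull_id]

/-- The ideal of elements whose meet with `a` lies in `I`. -/
def Idl.colon {A : IBool J} (I : Idl A U) (a : A.obj.obj (op U)) : Idl A U :=
  ⟨{ carrier := fun V f => {b : A.obj.obj (op V) | I.Mem f (b ⊓ A.obj.map f.op a)}
     restrict := fun V f (b : A.obj.obj (op V)) (h : I.Mem f _) W g => by
      change I.Mem _ (A.obj.map g.op b ⊓ A.obj.map (g ≫ f).op a)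
      rw [← map_map, ← map_inf]
      exact I.mem_restrict h g
     isLocal := fun V f (b : A.obj.obj (op V)) R hR h => I.mem_local hR fun W g hg => by
      rw [map_inf, map_map]
      exact h g hg },
    fun V f => ⟨I.mem_of_le inf_le_left I.mem_bot,
      fun _ _ h => I.mem_of_le (inf_le_inf_right _ h),
      fun b b' h h' => by
        change I.Mem f ((b ⊔ b' : A.obj.obj (op V)) ⊓ _)
        rw [inf_sup_right]
        exact I.mem_sup h h'⟩⟩

theorem Idl.mem_colon {A : IBool J} {I : Idl A U} {a b : A.obj.obj (op U)} :
    (I.colon a).Mem (𝟙 U) b ↔ I.Mem (𝟙 U) (b ⊓ a) := by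
  change I.Mem _ (b ⊓ A.obj.map (𝟙 U).op a) ↔ _
  rw [op_id, Functor.map_id_apply]

theorem le_pre_iff {I : Idl (Clop (graphLocale X Y)) U}
    {c : (Clop (graphLocale X Y)).obj.obj (op U)} :
    toGraphOpen c ≤ pre hY (satisfiesRelations_clopenGenerators hY) I ↔ I.Mem (𝟙 U) c := by
  have le_pre_of_mem {I : Idl (Clop (graphLocale X Y)) U}
      {c : (Clop (graphLocale X Y)).obj.obj (op U)} (h : I.Mem (𝟙 U) c) :
      toGraphOpen c ≤ pre hY (satisfiesRelations_clopenGenerators hY) I := fun V f l hl => by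
    refine I.mem_of_le ((word_le_map_iff hY).2 hl) ?_
    simpa only [Category.comp_id] using I.mem_restrict h f
  refine ⟨fun h => ?_, le_pre_of_mem⟩
  have top_le_pre_colon :
      ⊤ ≤ pre hY (satisfiesRelations_clopenGenerators hY) (I.colon c) := by
    rw [← (isCompl_toGraphOpen c).sup_eq_top]
    refine sup_le (h.trans fun V f l hl => I.mem_of_le inf_le_left hl) (le_pre_of_mem ?_)
    rw [Idl.mem_colon, compl_inf_self]
    exact I.mem_bot
  simpa only [Idl.mem_colon, top_inf_eq] using mem_top_of_top_le_pre hY _ top_le_pre_colon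

theorem clopensBelow_pre (I : Idl (Clop (graphLocale X Y)) U) :
    clopensBelow (pre hY (satisfiesRelations_clopenGenerators hY) I) = I :=
  Subtype.ext <| LocalFamily.ext_mem fun V f d => by
    change toGraphOpen d ≤ pre hY (satisfiesRelations_clopenGenerators hY) (I.pull f) ↔ I.Mem f d
    rw [le_pre_iff, Idl.mem_pull_id]

variable (X) in
theorem isStone_graphLocale (hY : IsDecidableFinite Y) : IsStone (graphLocale X Y) :=
  ⟨Clop (graphLocale X Y), fun U => show GraphOpen J X.obj Y.obj U ≃o _ from
    { toFun := clopensBelow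
      invFun := pre hY (satisfiesRelations_clopenGenerators hY)
      left_inv := pre_clopensBelow hY
      right_inv := clopensBelow_pre hY
      map_rel_iff' := fun {c d} => by
        refine ⟨fun h => ?_, fun h => clopensBelow_mono h⟩
        rw [← pre_clopensBelow hY c, ← pre_clopensBelow hY d]
        exact fun V f l => h f _ },
    fun _ _ f c => clopensBelow_pull c f⟩

variable {A : IBool J} {δ : Generators X Y A} {hY}

theorem represents_elt {hδ : SatisfiesRelations δ} (x : X.obj.obj (op U))
    (y : Y.obj.obj (op U)) :
    Represents hY hδ ((clopenGenerators X hY).elt x y) (δ.elt x y) where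
  le := GraphOpen.gen_le_iff.2 <| mem_below.2 <| by
    rw [word_singleton, op_id, Functor.map_id_apply]
  compl_le := by
    have mem_gen : (GraphOpen.gen J x y).Mem (𝟙 U) {(x, y)} := GraphOpen.gen_le_iff.1 le_rfl
    rw [← δ.word_singleton]
    exact le_below_compl_word (isCompl_toGraphOpen ((clopenGenerators X hY).elt x y)).disjoint
      mem_gen

variable (hY) (hδ : SatisfiesRelations δ)

/-- The value at a clopen of the homomorphism which extends `δ`. -/
def clopenValue (c : (Clop (graphLocale X Y)).obj.obj (op U)) : A.obj.obj (op U) :=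
  (exists_represents hY hδ c).choose

theorem represents_clopenValue (c : (Clop (graphLocale X Y)).obj.obj (op U)) :
    Represents hY hδ c (clopenValue hY hδ c) :=
  (exists_represents hY hδ c).choose_spec

/-- The homomorphism from the clopens of `Y ^ X` which extends `δ`. -/
def clopenHom : (Clop (graphLocale X Y)).obj ⟶ A.obj where
  app _ := BoolAlg.ofHom
    { toFun := clopenValue hY hδ
      map_sup' := fun c d => (represents_clopenValue hY hδ (c ⊔ d)).unique
        ((represents_clopenValue hY hδ c).sup (represents_clopenValue hY hδ d))
      map_inf' := fun c d => (represents_clopenValue hY hδ (c ⊓ d)).unique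
        ((represents_clopenValue hY hδ c).inf (represents_clopenValue hY hδ d))
      map_top' := (represents_clopenValue hY hδ ⊤).unique .top
      map_bot' := (represents_clopenValue hY hδ ⊥).unique .bot }
  naturality _ _ f := ConcreteCategory.hom_ext _ _ fun c =>
    (represents_clopenValue hY hδ ((Clop (graphLocale X Y)).obj.map f c)).unique
      ((represents_clopenValue hY hδ c).pull f.unop)

variable {hY hδ}

theorem toGraphOpen_le_below_of_hom {φ : (Clop (graphLocale X Y)).obj ⟶ A.obj}
    (hφ : ∀ ⦃U : C⦄ (x : X.obj.obj (op U)) (y : Y.obj.obj (op U)),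
      φ.app (op U) ((clopenGenerators X hY).elt x y) = δ.elt x y)
    (c : (Clop (graphLocale X Y)).obj.obj (op U)) :
    toGraphOpen c ≤ below hY hδ (φ.app (op U) c) := by
  intro V f l hl
  have hom_word : φ.app (op V) ((clopenGenerators X hY).word l) = δ.word l :=
    (map_finset_inf (φ.app (op V)).hom l _).trans (Finset.inf_congr rfl fun p _ => hφ p.1 p.2)
  rw [mem_below, ← hom_word, ← NatTrans.naturality_apply φ f.op c]
  exact OrderHomClass.mono (φ.app (op V)).hom ((word_le_map_iff hY).2 hl)

theorem represents_hom {φ : (Clop (graphLocale X Y)).obj ⟶ A.obj}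
    (hφ : ∀ ⦃U : C⦄ (x : X.obj.obj (op U)) (y : Y.obj.obj (op U)),
      φ.app (op U) ((clopenGenerators X hY).elt x y) = δ.elt x y)
    (c : (Clop (graphLocale X Y)).obj.obj (op U)) :
    Represents hY hδ c (φ.app (op U) c) where
  le := toGraphOpen_le_below_of_hom hφ c
  compl_le := by
    rw [← map_compl']
    exact toGraphOpen_le_below_of_hom hφ cᶜ

variable (X hY) in
theorem isPresentedBy_clopenGenerators : IsPresentedBy (clopenGenerators X hY) where
  relations := satisfiesRelations_clopenGenerators hY
  universal A δ hδ := by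
    refine ⟨clopenHom hY hδ, fun U x y => ?_, fun φ hφ => ?_⟩
    · exact (represents_clopenValue hY hδ _).unique (represents_elt x y)
    · ext _ c
      exact (represents_hom hφ c).unique (represents_clopenValue hY hδ c)

end ClopenPresentation

end InternalLocale

theorem proposition9p4 {C : Type u} [SmallCategory C] (J : GrothendieckTopology C)
    (X Y : Sheaf J (Type u)) (hY : InternalLocale.IsStone (InternalLocale.discrete Y)) :
    ∃ (W : InternalLocale.ILocale J) (p : BinaryFan W (InternalLocale.discrete X))
      (hp : IsLimit p) (ev : p.pt ⟶ InternalLocale.discrete Y),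
      InternalLocale.IsExponential p hp ev ∧
      InternalLocale.IsStone W ∧
      ∃ γ : InternalLocale.Generators X Y (InternalLocale.Clop W),
        (∀ ⦃U : C⦄ (x : X.obj.obj (op U)) (y : Y.obj.obj (op U)),
          InternalLocale.preim p.fst (InternalLocale.Clop.toOpen (γ.elt x y)) ⊓
              InternalLocale.preim p.snd (InternalLocale.point X x) =
            InternalLocale.preim ev (InternalLocale.point Y y) ⊓
              InternalLocale.preim p.snd (InternalLocale.point X x)) ∧
        InternalLocale.IsPresentedBy γ := by
  have hY := InternalLocale.isDecidableFinite_of_isStone hY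
  exact ⟨InternalLocale.graphLocale X Y, InternalLocale.prodFan _ X,
    InternalLocale.prodFanIsLimit _ X, InternalLocale.evalMap X Y,
    InternalLocale.isExponential_graphLocale X Y, InternalLocale.isStone_graphLocale X hY,
    InternalLocale.clopenGenerators X hY,
    fun _ x y => InternalLocale.preim_fst_gen_inf_preim_snd x y,
    InternalLocale.isPresentedBy_clopenGenerators X hY⟩
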